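/- \textbf{Setting.} There are $n$ agents. Agent $i$ has a nonnegative private value $v_i$ for being served, drawn independently from a distribution $F_i$; the sets of agents that may be served simultaneously form a downward closed family $\mathcal J\subseteq 2^{[n]}$. Assume that $\mathcal J$ is the intersection of $m$ matroids on $[n]$: a set is in $\mathcal J$ if and only if it is independent in each of them. \emph{Myerson's mechanism} $\mathcal M$ for virtual value functions $\phi_i$ serves, on (almost) every value profile $v$, a set $A\in\mathcal J$ that maximizes $\sum_{i\in A}\phi_i(v_i)$, ties being broken arbitrarily (as a measurable function of $v$); an agent that is not served pays nothing and an agent that is served pays the threshold bid, i.e. the infimum of the nonnegative bids with which it would be served, given the other bids (these payments being measurable in $v$). Let $q_i$ be the probability that $\mathcal M$ serves agent $i$, and $\mathcal R^{\mathcal M}$ its expected revenue. A \emph{sequential posted-price mechanism} (SPM) approaches the agents one after the other in a given order; an agent that can be feasibly added to those already served is offered service at its price and accepts if its value is at least this price. The served agents pay their prices. Prices may be random, independent of each other and of the values, and the price $\infty$ stands for no offer. \textbf{Theorem.} (1) Suppose that every $F_i$ is regular: it has a density $f_i$, positive exactly on an interval, on which $\phi_i(v)=v-\frac{1-F_i(v)}{f_i(v)}$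 is nondecreasing. Let $\mathcal M$ be Myerson's mechanism for the $\phi_i$, let $p_i=F_i^{-1}(1-q_i)$ (the largest price in $[0,\infty]$ that agent $i$ accepts with probability at least $q_i$), and let $\mathcal S$ be the SPM that posts the prices $p_i$ in decreasing order. Then $\mathcal R^{\mathcal M}\le (m+1)\,\mathcal R^{\mathcal S}$. (2) Let the $F_i$ be arbitrary (possibly irregular or with point masses). Let $\bar R_i(q)$ be the supremum of the expected revenues from offering agent $i$ alone a random price, equal to $\underline p$ with probability $x$ and to $\overline p$ with probability $1-x$ ($\underline p,\overline p\in[0,\infty]$), that is accepted with total probability exactly $q$; so $\bar R_i$ is the concave hull of the revenue curve. The ironed virtual value $\bar\phi_i(v)$ is the (left) derivative of $\bar R_i$ at $q=\Pr[v_i\ge v]$. Let $\mathcal M$ be Myerson's mechanism for the $\bar\phi_i$. If all the $F_i$ have finite mean, then for every $i$ there is a random price of this kind that is accepted with probability exactly $q_i$ and has expected revenue $\bar R_i(q_i)$. Whenever, for each $i$, such a random price is chosen (with or without finite means), the SPM $\mathcal S$ that offers these random prices in decreasing order of $p_i=\bar R_i(q_i)/q_i$ (read as $0$ if $q_i=0$)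 satisfies $\mathcal R^{\mathcal M}\le (m+1)\,\mathcal R^{\mathcal S}$. In both parts ties in the order are broken arbitrarily. -/

import Mathlib

open MeasureTheory ProbabilityTheory
open scoped ENNReal NNReal

/-- An instance of the Bayesian single-parameter mechanism design problem with `n` agents: agent
`i` has a nonnegative value with law `dist i`, the values are independent, and exactly the sets of
agents in the downward closed family `feasible` may be served. -/
structure BSMD (n : ℕ) where
  dist : Fin n → Measure ℝ
  isProb : ∀ i, IsProbabilityMeasure (dist i)
  nonneg : ∀ i, ∀ᵐ v ∂(dist i), 0 ≤ v
  feasible : Set (Finset (Fin n))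
  down_closed : ∀ A B : Finset (Fin n), A ⊆ B → B ∈ feasible → A ∈ feasible

attribute [instance] BSMD.isProb

/-- The joint law of the value profile. -/
noncomputable def BSMD.valueLaw {n : ℕ} (I : BSMD n) : Measure (Fin n → ℝ) :=
  Measure.pi I.dist

/-- A mechanism maps a profile of values (bids) to the set of agents served and to the price paid
by each agent. -/
structure Mechanism (n : ℕ) where
  alloc : (Fin n → ℝ) → Finset (Fin n)
  pay : (Fin n → ℝ) → Fin n → ℝ

/-- The expected revenue of a mechanism. -/
noncomputable def Mechanism.revenue {n : ℕ} (M : Mechanism n) (I : BSMD n) : ℝ≥0∞ :=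
  ∫⁻ v, ∑ i, ENNReal.ofReal (M.pay v i) ∂I.valueLaw

/-- The probability that a mechanism serves agent `i`. -/
noncomputable def Mechanism.serveProb {n : ℕ} (M : Mechanism n) (I : BSMD n) (i : Fin n) : ℝ≥0∞ :=
  I.valueLaw {v | i ∈ M.alloc v}

open Classical in
/-- `M` is Myerson's mechanism for the (ironed) virtual value functions `φ`: it serves a feasible
set of maximum virtual surplus, ties being broken in any way, an agent who is not served pays
nothing, and an agent who is served pays the threshold bid, the infimum of the bids with which it
would have been served. Virtual values are only defined up to null sets of values, so the
optimality of the served set is required for almost every value profile (in particular `M` may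
turn down a bid that lies outside the support of the distribution). -/
structure IsMyersonMechanism {n : ℕ} (I : BSMD n) (φ : Fin n → ℝ → ℝ) (M : Mechanism n) :
    Prop where
  measurable_alloc : ∀ i, MeasurableSet {v | i ∈ M.alloc v}
  measurable_pay : ∀ i, Measurable fun v => M.pay v i
  feasible : ∀ v, M.alloc v ∈ I.feasible
  optimal : ∀ᵐ v ∂I.valueLaw, ∀ A ∈ I.feasible,
    ∑ i ∈ A, φ i (v i) ≤ ∑ i ∈ M.alloc v, φ i (v i)
  pay_eq : ∀ v, (∀ i, 0 ≤ v i) → ∀ i, M.pay v i =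
    if i ∈ M.alloc v then sInf {b : ℝ | 0 ≤ b ∧ i ∈ M.alloc (Function.update v i b)} else 0

/-! ### Regular distributions -/

/-- The virtual value `v - (1 - F v) / f v` for the distribution function `F` of `μ` and a
density `f`. -/
noncomputable def virtualValue (μ : Measure ℝ) (f : ℝ → ℝ) (v : ℝ) : ℝ :=
  v - (1 - cdf μ v) / f v

/-- `μ` is regular with density `f`: the virtual value is monotone. The virtual value is read as
`-∞` where `f` vanishes below the top of the support, so the set `{f > 0}` on which it is finite
has to be an interval. -/
structure IsRegularDist (μ : Measure ℝ) (f : ℝ → ℝ) : Prop where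
  measurable : Measurable f
  nonneg : ∀ v, 0 ≤ f v
  density : μ = volume.withDensity fun v => ENNReal.ofReal (f v)
  interval : {v | 0 < f v}.OrdConnected
  monotone : MonotoneOn (virtualValue μ f) {v | 0 < f v}

/-! ### Posted prices

Prices are elements of `[0, ∞]`; the price `∞` is never accepted and stands for making no offer. -/

/-- The probability that an agent with value law `μ` accepts the price `p`. -/
noncomputable def acceptProb (μ : Measure ℝ) (p : ℝ≥0∞) : ℝ≥0∞ :=
  μ {v | p ≤ ENNReal.ofReal v}

/-- The price `F⁻¹(1 - q)`, as the largest price that is accepted with probability at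
least `q`. -/
noncomputable def quantilePrice (μ : Measure ℝ) (q : ℝ≥0∞) : ℝ≥0∞ :=
  sSup {p | q ≤ acceptProb μ p}

/-- A random price: `lo` with probability `x` and `hi` with probability `1 - x`. -/
structure PriceLottery where
  lo : ℝ≥0∞
  hi : ℝ≥0∞
  x : ℝ≥0
  x_le_one : x ≤ 1

namespace PriceLottery

/-- The law of the random price. -/
noncomputable def law (L : PriceLottery) : Measure ℝ≥0∞ :=
  L.x • Measure.dirac L.lo + (1 - L.x) • Measure.dirac L.hi

/-- The probability that an agent with value law `μ` accepts the random price. -/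
noncomputable def saleProb (L : PriceLottery) (μ : Measure ℝ) : ℝ≥0∞ :=
  L.x * acceptProb μ L.lo + ((1 - L.x : ℝ≥0) : ℝ≥0∞) * acceptProb μ L.hi

/-- The expected revenue from offering the random price to an agent with value law `μ`. -/
noncomputable def revenue (L : PriceLottery) (μ : Measure ℝ) : ℝ≥0∞ :=
  L.x * (L.lo * acceptProb μ L.lo) +
    ((1 - L.x : ℝ≥0) : ℝ≥0∞) * (L.hi * acceptProb μ L.hi)

/-- The expected payment conditioned on a sale. -/
noncomputable def effectivePrice (L : PriceLottery) (μ : Measure ℝ) : ℝ≥0∞ :=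
  L.revenue μ / L.saleProb μ

end PriceLottery

/-- The ironed revenue curve: the concave hull, evaluated at `q`, of the curve of pairs
(probability of sale, expected revenue) that posted prices generate. -/
noncomputable def ironedRevenue (μ : Measure ℝ) (q : ℝ≥0∞) : ℝ≥0∞ :=
  ⨆ (L : PriceLottery) (_ : L.saleProb μ = q), L.revenue μ

/-- The ironed virtual value of `v`: the slope of the ironed revenue curve at the quantile
`q = Pr[value ≥ v]`. It is the left derivative, so that it is also right at a point mass, whose
quantiles form an interval with right end point `q` on which the curve is affine. -/
noncomputable def ironedVirtualValue (μ : Measure ℝ) (v : ℝ) : ℝ :=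
  derivWithin (fun q : ℝ => (ironedRevenue μ (ENNReal.ofReal q)).toReal)
    (Set.Iic (μ.real (Set.Ici v))) (μ.real (Set.Ici v))

/-- The random price `L` sells to an agent with value law `μ` with probability exactly `q`, and
with the largest expected revenue that is possible at this probability of sale. -/
def PriceLottery.IsOptimal (L : PriceLottery) (μ : Measure ℝ) (q : ℝ≥0∞) : Prop :=
  L.saleProb μ = q ∧ L.revenue μ = ironedRevenue μ q

/-! ### Sequential posted-price mechanisms -/

open Classical in
/-- The set of agents that are served when the agents are approached in the order
`σ 0, σ 1, …` and each agent that can feasibly be added to those served so far is offered its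
price `p i`, which it accepts if its value is at least `p i`. -/
noncomputable def spmServed {n : ℕ} (I : BSMD n) (σ : Equiv.Perm (Fin n)) (v : Fin n → ℝ)
    (p : Fin n → ℝ≥0∞) : Finset (Fin n) :=
  (List.finRange n).foldl
    (fun A k => if insert (σ k) A ∈ I.feasible ∧ p (σ k) ≤ ENNReal.ofReal (v (σ k))
      then insert (σ k) A else A) ∅

/-- The expected revenue of the sequential posted-price mechanism with order `σ` and with
independent random prices of laws `price i`, drawn independently of the values. -/
noncomputable def spmRevenue {n : ℕ} (I : BSMD n) (σ : Equiv.Perm (Fin n))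
    (price : Fin n → Measure ℝ≥0∞) : ℝ≥0∞ :=
  ∫⁻ ω, ∑ i ∈ spmServed I σ ω.1 ω.2, ω.2 i ∂(I.valueLaw.prod (Measure.pi price))

/-! ### Acceptance probabilities of posted prices -/

section AcceptProb

open Filter Topology

/-! Write `q i` for the probability that Myerson's mechanism serves agent `i` and `e i` for the
price, or expected payment given a sale, that the SPM assigns to it. Both revenues are compared with
`∑ i, e i * q i`.

Upper bound on Myerson: fix the other agents' values. Agent `i` then pays a threshold `t` whenever
served, and is served with some probability `s ≤ Pr[v_i ≥ t]`. The point `(s, t * s)` lies on the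
segment from the origin to the point of the revenue curve at price `t`, hence below every line that
supports this curve. Averaging over the other values turns `s` into `q i`, so the expected payment
is at most the height of the line at `q i`. For a regular distribution the line is the tangent, with
the virtual value as slope (`IsRegularDist.isSupportingSlope`); in general it supports the concave
hull (`exists_isSupportingSlope`).

Lower bound on the SPM: whether an agent is still available is independent of its own value and
price, so an available agent buys with probability `q i`. An unavailable agent is blocked by one of
the `m` matroids. For a fixed run and a fixed matroid, augmentation shows that a feasible set
contains at most as many blocked agents among the first `k + 1` as the SPM has served there
(`card_blocked_le`). Applied to the set served by Myerson on fresh values and averaged, this bounds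
the sum of `q` over blocked agents. As prices decrease along the order, summation by parts charges
the blocked part of `∑ e * q` to the agents served. Available agents contribute the SPM revenue once
in expectation, and each matroid contributes it at most once more: `m + 1` in all.

Optimal lotteries exist under finite means by compactness: limit points of a maximizing sequence
that carry weight lie on a supporting line, and can be traded for actual prices on that line. -/

lemma acceptProb_top (μ : Measure ℝ) : acceptProb μ ∞ = 0 := by
  simp [acceptProb]

lemma acceptProb_zero (μ : Measure ℝ) [IsProbabilityMeasure μ] : acceptProb μ 0 = 1 := by
  simp [acceptProb]

lemma acceptProb_antitone (μ : Measure ℝ) : Antitone (acceptProb μ) :=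
  fun _ _ h => measure_mono fun _ hv => h.trans hv

lemma acceptProb_le_one (μ : Measure ℝ) [IsProbabilityMeasure μ] (p : ℝ≥0∞) :
    acceptProb μ p ≤ 1 := prob_le_one

lemma acceptProb_ne_top (μ : Measure ℝ) [IsProbabilityMeasure μ] (p : ℝ≥0∞) :
    acceptProb μ p ≠ ∞ := measure_ne_top _ _

lemma mul_acceptProb_ne_top (μ : Measure ℝ) [IsProbabilityMeasure μ] (p : ℝ≥0∞) :
    p * acceptProb μ p ≠ ∞ := by
  rcases eq_or_ne p ∞ with rfl | hp
  · simp [acceptProb_top]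
  · exact ENNReal.mul_ne_top hp (acceptProb_ne_top μ p)

/-- Acceptance probabilities are continuous from the left. -/
lemma le_acceptProb_of_forall_lt {μ : Measure ℝ} [IsProbabilityMeasure μ] {a p : ℝ≥0∞}
    (ha : a ≤ 1) (h : ∀ p' < p, a ≤ acceptProb μ p') : a ≤ acceptProb μ p := by
  rcases eq_or_ne p 0 with rfl | hp
  · rwa [acceptProb_zero]
  obtain ⟨u, hu, hup, hlim⟩ := exists_seq_strictMono_tendsto' (pos_iff_ne_zero.2 hp)
  have hset : {v : ℝ | p ≤ ENNReal.ofReal v} = ⋂ k, {v | u k ≤ ENNReal.ofReal v} := by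
    ext v
    simp only [Set.mem_ofPred_eq, Set.mem_iInter]
    exact ⟨fun hv k => (hup k).2.le.trans hv, fun hv => le_of_tendsto' hlim hv⟩
  have hm := tendsto_measure_iInter_atTop (μ := μ) (s := fun k => {v | u k ≤ ENNReal.ofReal v})
    (fun k => (measurableSet_le measurable_const
      ENNReal.measurable_ofReal).nullMeasurableSet)
    (fun i j hij v hv => (hu.monotone hij).trans hv) ⟨0, measure_ne_top _ _⟩
  rw [← hset] at hm
  exact ge_of_tendsto' hm fun k => h _ (hup k).2

/-- Only an inequality holds: prices that decrease to an atom lose its mass in the limit. -/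
lemma tendsto_acceptProb_le {μ : Measure ℝ} [IsProbabilityMeasure μ] {u : ℕ → ℝ≥0∞} {p a : ℝ≥0∞}
    (hu : Tendsto u atTop (𝓝 p)) (ha : Tendsto (fun k => acceptProb μ (u k)) atTop (𝓝 a)) :
    a ≤ acceptProb μ p := by
  refine le_acceptProb_of_forall_lt (le_of_tendsto' ha fun k => acceptProb_le_one μ _) ?_
  intro p' hp'
  refine le_of_tendsto ha ?_
  filter_upwards [hu.eventually (lt_mem_nhds hp')] with k hk
  exact acceptProb_antitone μ hk.le

/-- The quantile price is accepted with at least the required probability. -/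
lemma le_acceptProb_quantilePrice {μ : Measure ℝ} [IsProbabilityMeasure μ] {q : ℝ≥0∞}
    (hq : q ≤ 1) : q ≤ acceptProb μ (quantilePrice μ q) := by
  refine le_acceptProb_of_forall_lt hq fun p' hp' => ?_
  obtain ⟨p, hp, hlt⟩ := lt_sSup_iff.1 hp'
  exact le_trans hp (acceptProb_antitone μ hlt.le)

lemma le_quantilePrice {μ : Measure ℝ} {q p : ℝ≥0∞} (h : q ≤ acceptProb μ p) :
    p ≤ quantilePrice μ q := le_sSup h

lemma quantilePrice_zero (μ : Measure ℝ) : quantilePrice μ 0 = ∞ :=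
  top_unique (le_quantilePrice zero_le)

lemma quantilePrice_ne_top {μ : Measure ℝ} [IsProbabilityMeasure μ] {q : ℝ≥0∞} (h0 : q ≠ 0)
    (hq : q ≤ 1) : quantilePrice μ q ≠ ∞ := by
  intro h
  have := le_acceptProb_quantilePrice (μ := μ) hq
  rw [h, acceptProb_top] at this
  exact h0 (le_antisymm this zero_le)

end AcceptProb

/-! ### Price lotteries and the ironed revenue curve -/

namespace PriceLottery

variable (L : PriceLottery) (μ : Measure ℝ)

instance : IsProbabilityMeasure L.law := by
  constructor
  have h : (L.x : ℝ≥0∞) + ((1 - L.x : ℝ≥0) : ℝ≥0∞) = 1 := by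
    rw [← ENNReal.coe_add, add_tsub_cancel_of_le L.x_le_one, ENNReal.coe_one]
  rw [law, Measure.add_apply, Measure.smul_apply, Measure.smul_apply, measure_univ, measure_univ,
    ENNReal.smul_def, ENNReal.smul_def, smul_eq_mul, smul_eq_mul, mul_one, mul_one, h]

lemma lintegral_law {g : ℝ≥0∞ → ℝ≥0∞} :
    ∫⁻ p, g p ∂L.law = L.x * g L.lo + ((1 - L.x : ℝ≥0) : ℝ≥0∞) * g L.hi := by
  rw [law, lintegral_add_measure, lintegral_smul_measure, lintegral_smul_measure,
    lintegral_dirac, lintegral_dirac]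
  rfl

/-- The lottery that offers a single price. -/
def single (p : ℝ≥0∞) : PriceLottery := ⟨p, p, 1, le_rfl⟩

/-- The lottery of two prices, with a real weight in `[0, 1]`. -/
noncomputable def mix (p p' : ℝ≥0∞) (x : ℝ) (hx : x ≤ 1) : PriceLottery :=
  ⟨p, p', x.toNNReal, Real.toNNReal_le_one.2 hx⟩

lemma coe_one_sub_x : ((1 - L.x : ℝ≥0) : ℝ) = 1 - L.x := NNReal.coe_sub L.x_le_one

lemma revenue_eq_zero (h : L.saleProb μ = 0) : L.revenue μ = 0 := by
  simp only [saleProb, add_eq_zero, mul_eq_zero] at h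
  simp only [revenue, add_eq_zero, mul_eq_zero]
  tauto

lemma revenue_le_ironedRevenue : L.revenue μ ≤ ironedRevenue μ (L.saleProb μ) :=
  le_iSup₂ (f := fun (L' : PriceLottery) (_ : L'.saleProb μ = L.saleProb μ) => L'.revenue μ) L rfl

variable [IsProbabilityMeasure μ]

lemma saleProb_ne_top : L.saleProb μ ≠ ∞ :=
  ENNReal.add_ne_top.2 ⟨ENNReal.mul_ne_top ENNReal.coe_ne_top (acceptProb_ne_top μ _),
    ENNReal.mul_ne_top ENNReal.coe_ne_top (acceptProb_ne_top μ _)⟩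

lemma revenue_ne_top : L.revenue μ ≠ ∞ :=
  ENNReal.add_ne_top.2 ⟨ENNReal.mul_ne_top ENNReal.coe_ne_top (mul_acceptProb_ne_top μ _),
    ENNReal.mul_ne_top ENNReal.coe_ne_top (mul_acceptProb_ne_top μ _)⟩

lemma toReal_saleProb : (L.saleProb μ).toReal =
    L.x * (acceptProb μ L.lo).toReal + (1 - L.x) * (acceptProb μ L.hi).toReal := by
  rw [saleProb, ENNReal.toReal_add (ENNReal.mul_ne_top ENNReal.coe_ne_top (acceptProb_ne_top μ _))
    (ENNReal.mul_ne_top ENNReal.coe_ne_top (acceptProb_ne_top μ _)), ENNReal.toReal_mul,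
    ENNReal.toReal_mul, ENNReal.coe_toReal, ENNReal.coe_toReal, coe_one_sub_x]

lemma toReal_revenue : (L.revenue μ).toReal =
    L.x * (L.lo * acceptProb μ L.lo).toReal + (1 - L.x) * (L.hi * acceptProb μ L.hi).toReal := by
  rw [revenue, ENNReal.toReal_add
    (ENNReal.mul_ne_top ENNReal.coe_ne_top (mul_acceptProb_ne_top μ _))
    (ENNReal.mul_ne_top ENNReal.coe_ne_top (mul_acceptProb_ne_top μ _)), ENNReal.toReal_mul,
    ENNReal.toReal_mul (a := ((1 - L.x : ℝ≥0) : ℝ≥0∞)), ENNReal.coe_toReal, ENNReal.coe_toReal, coe_one_sub_x]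

/-- Without sales the effective price is `0 / 0 = 0`, and the revenue vanishes as well. -/
lemma effectivePrice_mul_saleProb : L.effectivePrice μ * L.saleProb μ = L.revenue μ := by
  rcases eq_or_ne (L.saleProb μ) 0 with h | h
  · rw [h, mul_zero, revenue_eq_zero L μ h]
  · exact ENNReal.div_mul_cancel h (saleProb_ne_top L μ)

end PriceLottery

/-- The line through `(q, r)` of slope `c` lies above all pairs (probability of sale, revenue) of
posted prices. -/
def IsSupportingSlope (μ : Measure ℝ) (q r c : ℝ) : Prop :=
  ∀ p : ℝ≥0∞, (p * acceptProb μ p).toReal ≤ r + c * ((acceptProb μ p).toReal - q)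

/-- Concavity in the form needed below: a chord over `q` between two points of the curve is itself a
lottery competing in the supremum. -/
lemma mix_revenue_le {μ : Measure ℝ} [IsProbabilityMeasure μ] {q : ℝ≥0∞} (hq : q ≠ ∞)
    (hfin : ironedRevenue μ q ≠ ∞) {p p' : ℝ≥0∞} {x : ℝ} (h0 : 0 ≤ x) (h1 : x ≤ 1)
    (h : x * (acceptProb μ p).toReal + (1 - x) * (acceptProb μ p').toReal = q.toReal) :
    x * (p * acceptProb μ p).toReal + (1 - x) * (p' * acceptProb μ p').toReal
      ≤ (ironedRevenue μ q).toReal := by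
  have hx : ((PriceLottery.mix p p' x h1).x : ℝ) = x := Real.coe_toNNReal x h0
  have hs : (PriceLottery.mix p p' x h1).saleProb μ = q := by
    rw [← ENNReal.toReal_eq_toReal_iff' (PriceLottery.saleProb_ne_top _ _) hq,
      PriceLottery.toReal_saleProb, hx]
    exact h
  have := (PriceLottery.mix p p' x h1).revenue_le_ironedRevenue μ
  rw [hs, ← ENNReal.toReal_le_toReal (PriceLottery.revenue_ne_top _ _) hfin,
    PriceLottery.toReal_revenue, hx] at this
  exact this

/-- A finite ironed revenue curve has a supporting line at every interior point. -/
lemma exists_isSupportingSlope {μ : Measure ℝ} [IsProbabilityMeasure μ] {q : ℝ≥0∞} (h0 : 0 < q)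
    (h1 : q < 1) (hfin : ironedRevenue μ q ≠ ∞) :
    ∃ c, IsSupportingSlope μ q.toReal (ironedRevenue μ q).toReal c := by
  have hq : q ≠ ∞ := (h1.trans ENNReal.one_lt_top).ne
  have hq0 : 0 < q.toReal := ENNReal.toReal_pos h0.ne' hq
  have hq1 : q.toReal < 1 := by
    rw [← ENNReal.toReal_one]; exact (ENNReal.toReal_lt_toReal hq ENNReal.one_ne_top).2 h1
  set r := (ironedRevenue μ q).toReal
  set A : ℝ≥0∞ → ℝ := fun p => (acceptProb μ p).toReal
  set P : ℝ≥0∞ → ℝ := fun p => (p * acceptProb μ p).toReal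
  have hmix : ∀ p p' x, 0 ≤ x → x ≤ 1 → x * A p + (1 - x) * A p' = q.toReal →
      x * P p + (1 - x) * P p' ≤ r := fun p p' x => mix_revenue_le hq hfin
  -- Since chords over `q` stay below `r`, slopes from `(q, r)` to points on its right are at most
  -- slopes to points on its left; `c` separates them. The prices `0` and `∞` make both families
  -- nonempty.
  obtain ⟨c, hc1, hc2⟩ := exists_between_of_forall_le
    (s := (fun p => (P p - r) / (A p - q.toReal)) '' {p | q.toReal < A p})
    (t := (fun p => (r - P p) / (q.toReal - A p)) '' {p | A p < q.toReal})
    ⟨_, 0, by simpa [A, acceptProb_zero] using hq1, rfl⟩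
    ⟨_, ∞, by simpa [A, acceptProb_top] using hq0, rfl⟩ (by
      rintro _ ⟨p, hp, rfl⟩ _ ⟨p', hp', rfl⟩
      simp only [Set.mem_ofPred_eq] at hp hp'
      have h1 : 0 < A p - q.toReal := by linarith
      have h2 : 0 < q.toReal - A p' := by linarith
      have h3 : 0 < A p - A p' := by linarith
      have := hmix p p' ((q.toReal - A p') / (A p - A p')) (by positivity)
        ((div_le_one h3).2 (by linarith)) (by field_simp; ring)
      rw [div_le_div_iff₀ h1 h2]
      have e : 1 - (q.toReal - A p') / (A p - A p') = (A p - q.toReal) / (A p - A p') := by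
        field_simp; ring
      rw [e, div_mul_eq_mul_div, div_mul_eq_mul_div, ← add_div, div_le_iff₀ h3] at this
      linarith)
  refine ⟨c, fun p => ?_⟩
  change P p ≤ r + c * (A p - q.toReal)
  rcases lt_trichotomy (A p) q.toReal with h | h | h
  · have := hc2 ⟨p, h, rfl⟩
    rw [le_div_iff₀ (by linarith)] at this
    linarith
  · have := hmix p p 1 zero_le_one le_rfl (by linarith)
    rw [h]; linarith
  · have := hc1 ⟨p, h, rfl⟩
    rw [div_le_iff₀ (by linarith)] at this
    linarith

/-! ### Regular distributions -/

section Regular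

/-- Integration by parts for absolutely continuous functions: `f` is merely integrable, so its
primitive is differentiable only almost everywhere. -/
lemma sub_mul_sub_eq_integral {f : ℝ → ℝ} {a b : ℝ} (hf : IntervalIntegrable f volume a b)
    (k c : ℝ) :
    (b - c) * (k - ∫ t in a..b, f t) - (a - c) * k =
      ∫ u in a..b, ((k - ∫ t in a..u, f t) - f u * (u - c)) := by
  have hF := (hf.absolutelyContinuousOnInterval_intervalIntegral (c := a) (by simp))
  have hk : AbsolutelyContinuousOnInterval (fun _ : ℝ => k) a b :=
    (LipschitzWith.const k).lipschitzOnWith.absolutelyContinuousOnInterval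
  have hc : AbsolutelyContinuousOnInterval (fun u : ℝ => u - c) a b :=
    (LipschitzWith.of_dist_le_mul (K := 1)
      (fun x y => by simp)).lipschitzOnWith.absolutelyContinuousOnInterval
  have h := hc.integral_deriv_mul_eq_sub (hk.sub hF)
  simp only [Pi.sub_apply, intervalIntegral.integral_same, sub_zero] at h
  rw [← h]
  refine intervalIntegral.integral_congr_ae ?_
  filter_upwards [hf.ae_hasDerivAt_integral] with u hu hmem
  have hd := (hu (Set.uIoc_subset_uIcc hmem) a (by simp)).const_sub k
  have hd' : deriv ((fun _ : ℝ => k) - fun x => ∫ t in a..x, f t) u = -f u := hd.deriv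
  have hid : deriv (fun u : ℝ => u - c) u = 1 := ((hasDerivAt_id u).sub_const c).deriv
  rw [hd', hid]
  ring

variable {μ : Measure ℝ} {f : ℝ → ℝ}

lemma acceptProb_ofReal (h0 : ∀ᵐ v ∂μ, 0 ≤ v) (t : ℝ) :
    acceptProb μ (ENNReal.ofReal t) = μ (Set.Ici t) := by
  refine measure_congr ?_
  filter_upwards [h0] with v hv
  exact propext (ENNReal.ofReal_le_ofReal_iff hv)

lemma IsRegularDist.exists_pos (h : IsRegularDist μ f) {s : Set ℝ} (hs : MeasurableSet s)
    (hμ : μ s ≠ 0) : ∃ v ∈ s, 0 < f v := by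
  by_contra! hcon
  apply hμ
  rw [h.density, withDensity_apply _ hs, setLIntegral_congr_fun hs
    (g := fun _ => 0) (fun v hv => ENNReal.ofReal_of_nonpos (hcon v hv)), lintegral_zero]

lemma IsRegularDist.nullSingletonClass (h : IsRegularDist μ f) : NullSingletonClass μ := by
  rw [h.density]
  exact ⟨fun x => withDensity_absolutelyContinuous _ _ (measure_singleton x)⟩

variable [IsProbabilityMeasure μ]

lemma IsRegularDist.integrable (h : IsRegularDist μ f) : Integrable f volume := by
  refine ⟨h.measurable.aestronglyMeasurable, ?_⟩
  rw [hasFiniteIntegral_iff_ofReal (Filter.Eventually.of_forall h.nonneg)]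
  have : μ Set.univ = ∫⁻ v, ENNReal.ofReal (f v) := by
    conv_lhs => rw [h.density]
    simp
  rw [← this]
  exact measure_lt_top _ _

lemma IsRegularDist.real_Ici_sub (h : IsRegularDist μ f) {a b : ℝ} (hab : a ≤ b) :
    μ.real (Set.Ici a) - ∫ t in a..b, f t = μ.real (Set.Ici b) := by
  have := h.nullSingletonClass
  have h1 : μ.real (Set.Ioc a b) = ∫ t in a..b, f t := by
    rw [intervalIntegral.integral_of_le hab, integral_eq_lintegral_of_nonneg_ae
      (Filter.Eventually.of_forall h.nonneg) h.measurable.aestronglyMeasurable, measureReal_def]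
    conv_lhs => rw [h.density]
    rw [withDensity_apply _ measurableSet_Ioc]
  have h2 : μ.real (Set.Ioi a) = μ.real (Set.Ioc a b) + μ.real (Set.Ioi b) := by
    rw [← measureReal_union (by
      rw [Set.disjoint_left]; intro x hx hx'; exact not_le.2 hx' hx.2) measurableSet_Ioi,
      Set.Ioc_union_Ioi_eq_Ioi hab]
  have h3 : ∀ x, μ.real (Set.Ici x) = μ.real (Set.Ioi x) := fun x =>
    measureReal_congr Ioi_ae_eq_Ici.symm
  rw [h3, h3, h2, h1]
  ring

lemma IsRegularDist.one_sub_cdf (h : IsRegularDist μ f) (t : ℝ) :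
    1 - cdf μ t = μ.real (Set.Ici t) := by
  have := h.nullSingletonClass
  rw [cdf_eq_real, measureReal_congr (Ioi_ae_eq_Ici (μ := μ) (a := t)).symm,
    ← Set.compl_Iic, probReal_compl_eq_one_sub measurableSet_Iic]

/-- Every larger price is accepted with probability below `q`; without atoms this bound passes to
the limit. -/
lemma IsRegularDist.acceptProb_quantilePrice (h : IsRegularDist μ f) (h0 : ∀ᵐ v ∂μ, 0 ≤ v)
    {q : ℝ≥0∞} (hq : q ≤ 1) : acceptProb μ (quantilePrice μ q) = q := by
  rcases eq_or_ne q 0 with rfl | hq0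
  · rw [quantilePrice_zero, acceptProb_top]
  refine le_antisymm ?_ (le_acceptProb_quantilePrice hq)
  have hna := h.nullSingletonClass
  have hp := quantilePrice_ne_top (μ := μ) hq0 hq
  set c := (quantilePrice μ q).toReal with hc
  have hc0 : 0 ≤ c := ENNReal.toReal_nonneg
  rw [← ENNReal.ofReal_toReal hp, ← hc, acceptProb_ofReal h0,
    measure_congr (Ioi_ae_eq_Ici (μ := μ) (a := c)).symm]
  obtain ⟨u, hu, hcu, hlim⟩ := exists_seq_strictAnti_tendsto c
  have hset : Set.Ioi c = ⋃ k, Set.Ici (u k) := by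
    ext v
    simp only [Set.mem_Ioi, Set.mem_iUnion, Set.mem_Ici]
    refine ⟨fun hv => ?_, fun ⟨k, hk⟩ => (hcu k).trans_le hk⟩
    obtain ⟨k, hk⟩ := (hlim.eventually (gt_mem_nhds hv)).exists
    exact ⟨k, hk.le⟩
  rw [hset, (Monotone.measure_iUnion (fun i j hij => Set.Ici_subset_Ici.2 (hu.antitone hij)))]
  refine iSup_le fun k => ?_
  rw [← acceptProb_ofReal h0]
  by_contra hlt
  have := le_quantilePrice (not_le.1 hlt).le
  rw [← ENNReal.ofReal_toReal hp, ← hc, ENNReal.ofReal_le_ofReal_iff hc0] at this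
  exact absurd (hcu k) (not_lt.2 this)

/-- The revenue curve of a regular distribution lies below its tangent, whose slope is the virtual
value. -/
lemma IsRegularDist.isSupportingSlope (h : IsRegularDist μ f) (h0 : ∀ᵐ v ∂μ, 0 ≤ v)
    {q : ℝ≥0∞} (hq0 : 0 < q) (hq1 : q < 1) :
    IsSupportingSlope μ q.toReal (quantilePrice μ q * q).toReal
      (virtualValue μ f (quantilePrice μ q).toReal) := by
  have hna := h.nullSingletonClass
  have hp := quantilePrice_ne_top (μ := μ) hq0.ne' hq1.le
  have hacc := h.acceptProb_quantilePrice h0 hq1.le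
  set c := (quantilePrice μ q).toReal with hc
  have hc0 : 0 ≤ c := ENNReal.toReal_nonneg
  rw [← ENNReal.ofReal_toReal hp, ← hc, acceptProb_ofReal h0] at hacc
  set G : ℝ → ℝ := fun t => μ.real (Set.Ici t) with hG
  have hGc : G c = q.toReal := by rw [hG]; simp only [measureReal_def, hacc]
  obtain ⟨y, hcy, hy⟩ := h.exists_pos measurableSet_Ici (hacc.trans_ne hq0.ne')
  obtain ⟨x, hxc, hx⟩ := h.exists_pos (measurableSet_Iio (a := c)) (by
    rw [← Set.compl_Ici, prob_compl_eq_one_sub measurableSet_Ici, hacc]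
    exact (tsub_pos_of_lt hq1).ne')
  -- As `0 < q < 1`, there is mass on both sides of `c`, and the positivity set is an interval.
  have hfc : 0 < f c := h.interval.out hx hy ⟨le_of_lt hxc, hcy⟩
  set l := virtualValue μ f c with hl
  have hvv : ∀ u, virtualValue μ f u = u - G u / f u := fun u => by
    rw [virtualValue, h.one_sub_cdf]
  have hG0 : ∀ u, 0 ≤ G u := fun u => measureReal_nonneg
  have key : ∀ a b, a ≤ b → (b - l) * G b - (a - l) * G a =
      ∫ u in a..b, (G u - f u * (u - l)) := by
    intro a b hab
    rw [show G b = G a - ∫ t in a..b, f t from (h.real_Ici_sub hab).symm,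
      sub_mul_sub_eq_integral h.integrable.intervalIntegrable]
    refine intervalIntegral.integral_congr fun u hu => ?_
    rw [Set.uIcc_of_le hab] at hu
    simp only [hG, ← h.real_Ici_sub hu.1]
  -- The integrand equals `f u * (l - virtualValue μ f u)` where `f u > 0`. Monotonicity makes it
  -- nonnegative below `c` and nonpositive above, so `(t - l) * G t` peaks at `c`.
  have main : ∀ t, (t - l) * G t ≤ (c - l) * G c := by
    intro t
    rcases le_total t c with htc | htc
    · have : 0 ≤ ∫ u in t..c, (G u - f u * (u - l)) := by
        refine intervalIntegral.integral_nonneg htc fun u hu => ?_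
        rcases (h.nonneg u).eq_or_lt with hfu | hfu
        · rw [← hfu]; simpa using hG0 u
        · have hm := h.monotone hfu hfc hu.2
          rw [← hl, hvv, sub_le_comm, le_div_iff₀ hfu] at hm
          linarith
      linarith [key t c htc]
    · have : 0 ≤ ∫ u in c..t, -(G u - f u * (u - l)) := by
        refine intervalIntegral.integral_nonneg htc fun u hu => ?_
        rcases (h.nonneg u).eq_or_lt with hfu | hfu
        · have hGu : G u = 0 := by
            by_contra hne
            obtain ⟨w, huw, hw⟩ := h.exists_pos (s := Set.Ici u) measurableSet_Ici
              (fun h' => hne (by simp [hG, measureReal_def, h']))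
            have : 0 < f u := h.interval.out hfc hw ⟨hu.1, huw⟩
            exact this.ne hfu
          rw [hGu, ← hfu]; simp
        · have hm := h.monotone hfc hfu hu.1
          rw [← hl, hvv, le_sub_comm, div_le_iff₀ hfu] at hm
          linarith
      rw [intervalIntegral.integral_neg] at this
      linarith [key c t htc]
  intro p
  rw [ENNReal.toReal_mul, ENNReal.toReal_mul, ← hc, ← hGc]
  rcases eq_or_ne p ∞ with rfl | hpt
  · rw [acceptProb_top, ENNReal.toReal_zero, mul_zero]
    have : (c - l) * G c = G c / f c * G c := by rw [hl, hvv]; ring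
    have : 0 ≤ (c - l) * G c := by
      rw [this]; exact mul_nonneg (div_nonneg (hG0 _) hfc.le) (hG0 _)
    linarith
  · have ha : (acceptProb μ p).toReal = G p.toReal := by
      conv_lhs => rw [← ENNReal.ofReal_toReal hpt]
      rw [acceptProb_ofReal h0]; rfl
    rw [ha]
    linarith [main p.toReal]

end Regular

/-! ### Optimal lotteries -/

section Attained

open Filter Topology

/-- Markov's inequality, keeping the tail integral because it vanishes with the acceptance
probability. -/
lemma mul_acceptProb_le_lintegral (μ : Measure ℝ) (p : ℝ≥0∞) :
    p * acceptProb μ p ≤ ∫⁻ v in {v | p ≤ ENNReal.ofReal v}, ENNReal.ofReal v ∂μ := by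
  rw [acceptProb, ← setLIntegral_const]
  exact setLIntegral_mono ENNReal.measurable_ofReal fun v hv => hv

variable {μ : Measure ℝ}

lemma PriceLottery.revenue_le_of_forall {L : PriceLottery} {B : ℝ≥0∞}
    (h : ∀ p, p * acceptProb μ p ≤ B) : L.revenue μ ≤ B := by
  calc L.revenue μ ≤ L.x * B + ((1 - L.x : ℝ≥0) : ℝ≥0∞) * B :=
        add_le_add (mul_le_mul_right (h _) _) (mul_le_mul_right (h _) _)
    _ = B := by
        rw [← add_mul, ← ENNReal.coe_add, add_tsub_cancel_of_le L.x_le_one, ENNReal.coe_one,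
          one_mul]

/-- The posted price `p` generates a point on the line through `(q, r)` of slope `c`. -/
def OnLine (μ : Measure ℝ) (q r c : ℝ) (p : ℝ≥0∞) : Prop :=
  (p * acceptProb μ p).toReal = r + c * ((acceptProb μ p).toReal - q)

/-- The point `(a, p * a)` lies between the origin, which is the price `∞`, and the curve point of
`p`; the line is above both. -/
lemma IsSupportingSlope.le_of_le {q r c : ℝ} (hc : IsSupportingSlope μ q r c) {p : ℝ≥0∞} {a : ℝ}
    (h0 : 0 ≤ a) (ha : a ≤ (acceptProb μ p).toReal) : p.toReal * a ≤ r + c * (a - q) := by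
  have h1 := hc p
  have h2 := hc ∞
  rw [ENNReal.toReal_mul] at h1
  rw [acceptProb_top, mul_zero, ENNReal.toReal_zero] at h2
  rcases h0.eq_or_lt with rfl | h0
  · simpa using h2
  set A := (acceptProb μ p).toReal
  have hA : 0 < A := h0.trans_le ha
  have e : A * (p.toReal * a) ≤ A * (r + c * (a - q)) := by nlinarith
  exact le_of_mul_le_mul_left e hA

/-- A line that lies above a segment and touches it at an inner point contains the whole segment.
Thus a limit point on the line can be replaced by one of the end points, the price `p` or the price
`∞`. -/
lemma IsSupportingSlope.onLine {q r c : ℝ} (hc : IsSupportingSlope μ q r c) {p : ℝ≥0∞} {a : ℝ}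
    (h0 : 0 ≤ a) (ha : a ≤ (acceptProb μ p).toReal) (h : p.toReal * a = r + c * (a - q)) :
    (q ≤ a → 0 < q → OnLine μ q r c p) ∧
      (a ≤ q → ∃ p', OnLine μ q r c p' ∧ (acceptProb μ p').toReal ≤ q) := by
  have h1 := hc p
  have h2 := hc ∞
  rw [ENNReal.toReal_mul] at h1
  rw [acceptProb_top, mul_zero, ENNReal.toReal_zero] at h2
  set A := (acceptProb μ p).toReal with hA
  constructor
  · intro hqa hq
    rw [OnLine, ENNReal.toReal_mul, ← hA]
    refine le_antisymm h1 ?_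
    have e : a * (r + c * (A - q)) ≤ a * (p.toReal * A) := by nlinarith
    exact le_of_mul_le_mul_left e (hq.trans_le hqa)
  · intro haq
    rcases ha.eq_or_lt with haA | haA
    · exact ⟨p, by rw [OnLine, ENNReal.toReal_mul, ← hA, ← haA, h], by rw [← hA, ← haA]; exact haq⟩
    · refine ⟨∞, ?_, by rw [acceptProb_top, ENNReal.toReal_zero]; linarith⟩
      rw [OnLine, acceptProb_top, mul_zero, ENNReal.toReal_zero]
      refine le_antisymm h2 ?_
      have e : (A - a) * (r + c * (0 - q)) ≤ (A - a) * 0 := by nlinarith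
      exact le_of_mul_le_mul_left e (sub_pos.2 haA)

lemma ironedRevenue_ne_top (h : ∫⁻ v, ENNReal.ofReal v ∂μ ≠ ∞) (q : ℝ≥0∞) :
    ironedRevenue μ q ≠ ∞ :=
  ne_top_of_le_ne_top h <| iSup₂_le fun _ _ => PriceLottery.revenue_le_of_forall fun p =>
    (mul_acceptProb_le_lintegral μ p).trans (setLIntegral_le_lintegral _ _)

variable [IsProbabilityMeasure μ]

/-- Limit points of the curve of pairs (probability of sale, revenue) lie on segments that join a
point of the curve to the origin. -/
lemma tendsto_revenue_eq (h : ∫⁻ v, ENNReal.ofReal v ∂μ ≠ ∞) {u : ℕ → ℝ≥0∞} {p a : ℝ≥0∞}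
    (hu : Tendsto u atTop (𝓝 p)) (ha : Tendsto (fun k => acceptProb μ (u k)) atTop (𝓝 a)) :
    a ≤ acceptProb μ p ∧ Tendsto (fun k => u k * acceptProb μ (u k)) atTop (𝓝 (p * a)) := by
  have hle := tendsto_acceptProb_le hu ha
  refine ⟨hle, ?_⟩
  -- At `p = ∞` the product is `∞ * 0`; the finite mean forces the revenue to `0` there.
  rcases eq_or_ne p ∞ with rfl | hp
  · rw [acceptProb_top, nonpos_iff_eq_zero] at hle
    subst hle
    rw [mul_zero]
    exact tendsto_of_tendsto_of_tendsto_of_le_of_le tendsto_const_nhds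
      (tendsto_setLIntegral_zero h ha) (fun _ => zero_le) fun k => mul_acceptProb_le_lintegral μ _
  · exact ENNReal.Tendsto.mul hu (Or.inr (ne_top_of_le_ne_top (acceptProb_ne_top μ p) hle)) ha
      (Or.inr hp)

lemma exists_isOptimal_of_onLine {q : ℝ≥0∞} (hq : q ≠ ∞) (hfin : ironedRevenue μ q ≠ ∞) {c : ℝ}
    {p p' : ℝ≥0∞} (hp : OnLine μ q.toReal (ironedRevenue μ q).toReal c p)
    (hp' : OnLine μ q.toReal (ironedRevenue μ q).toReal c p')
    (h : (acceptProb μ p).toReal ≤ q.toReal) (h' : q.toReal ≤ (acceptProb μ p').toReal) :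
    ∃ L : PriceLottery, L.IsOptimal μ q := by
  obtain ⟨x, hx0, hx1, hx⟩ : ∃ x : ℝ, 0 ≤ x ∧ x ≤ 1 ∧
      x * (acceptProb μ p).toReal + (1 - x) * (acceptProb μ p').toReal = q.toReal := by
    obtain ⟨a, b, ha, hb, hab, e⟩ := (Convex.mem_Icc (h.trans h')).1 ⟨h, h'⟩
    exact ⟨a, ha, by linarith, by rw [← e, ← hab]; ring⟩
  have hL : ((PriceLottery.mix p p' x hx1).x : ℝ) = x := Real.coe_toNNReal x hx0
  refine ⟨PriceLottery.mix p p' x hx1, ?_, ?_⟩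
  · rw [← ENNReal.toReal_eq_toReal_iff' (PriceLottery.saleProb_ne_top _ _) hq,
      PriceLottery.toReal_saleProb, hL]
    exact hx
  · rw [← ENNReal.toReal_eq_toReal_iff' (PriceLottery.revenue_ne_top _ _) hfin,
      PriceLottery.toReal_revenue, hL]
    simp only [OnLine] at hp hp'
    simp only [PriceLottery.mix, hp, hp']
    linear_combination c * hx

/-- At the end point `1` a supporting line of finite slope may fail to exist. A certain sale
requires each price of positive weight to be accepted almost surely, hence to be at most
`quantilePrice μ 1`. -/
lemma ironedRevenue_one : ironedRevenue μ 1 = quantilePrice μ 1 ∧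
    (PriceLottery.single (quantilePrice μ 1)).IsOptimal μ 1 := by
  have hacc : acceptProb μ (quantilePrice μ 1) = 1 :=
    le_antisymm (acceptProb_le_one μ _) (le_acceptProb_quantilePrice le_rfl)
  have hs : (PriceLottery.single (quantilePrice μ 1)).saleProb μ = 1 := by
    simp [PriceLottery.saleProb, PriceLottery.single, hacc]
  have hr : (PriceLottery.single (quantilePrice μ 1)).revenue μ = quantilePrice μ 1 := by
    simp [PriceLottery.revenue, PriceLottery.single, hacc]
  have : ironedRevenue μ 1 = quantilePrice μ 1 := by
    refine le_antisymm (iSup₂_le fun L hL => ?_) ?_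
    · have h1 : ((1 - L.x : ℝ≥0) : ℝ≥0∞) + L.x = 1 := by
        rw [← ENNReal.coe_add, tsub_add_cancel_of_le L.x_le_one, ENNReal.coe_one]
      have aux : ∀ (x y : ℝ≥0) (p p' : ℝ≥0∞), (x : ℝ≥0∞) + y = 1 →
          x * acceptProb μ p + y * acceptProb μ p' = 1 →
          x * (p * acceptProb μ p) ≤ x * quantilePrice μ 1 := by
        intro x y p p' hxy hs
        rcases eq_or_ne x 0 with rfl | hx
        · simp
        refine mul_le_mul_right ?_ _
        have : 1 ≤ acceptProb μ p := by
          by_contra hlt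
          have h1 : x * acceptProb μ p + y * acceptProb μ p' < x * 1 + y * 1 := by
            refine ENNReal.add_lt_add_of_lt_of_le
              (ENNReal.mul_ne_top ENNReal.coe_ne_top (acceptProb_ne_top μ _)) ?_
              (mul_le_mul_right (acceptProb_le_one μ _) _)
            exact ENNReal.mul_lt_mul_right (by simpa using hx) ENNReal.coe_ne_top (not_le.1 hlt)
          rw [hs, mul_one, mul_one, hxy] at h1
          exact lt_irrefl _ h1
        calc p * acceptProb μ p ≤ p * 1 := mul_le_mul_right (acceptProb_le_one μ _) _
          _ ≤ _ := by rw [mul_one]; exact le_quantilePrice this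
      calc L.revenue μ ≤ L.x * quantilePrice μ 1 +
            ((1 - L.x : ℝ≥0) : ℝ≥0∞) * quantilePrice μ 1 :=
            add_le_add (aux _ (1 - L.x) _ L.hi (by rw [add_comm]; exact h1) hL)
              (aux _ L.x _ L.lo h1 (by rw [add_comm]; exact hL))
        _ = quantilePrice μ 1 := by rw [← add_mul, add_comm (L.x : ℝ≥0∞), h1, one_mul]
    · rw [← hr]
      conv_rhs => rw [← hs]
      exact PriceLottery.revenue_le_ironedRevenue _ _
  exact ⟨this, hs, hr.trans this.symm⟩

lemma exists_isOptimal (h : ∫⁻ v, ENNReal.ofReal v ∂μ ≠ ∞) {q : ℝ≥0∞} (hq1 : q ≤ 1) :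
    ∃ L : PriceLottery, L.IsOptimal μ q := by
  rcases eq_or_ne q 0 with rfl | hq0
  · refine ⟨PriceLottery.single ∞, by simp [PriceLottery.saleProb, PriceLottery.single,
      acceptProb_top], ?_⟩
    rw [PriceLottery.revenue_eq_zero _ _ (by simp [PriceLottery.saleProb, PriceLottery.single,
      acceptProb_top])]
    exact (le_antisymm (iSup₂_le fun L hL => (L.revenue_eq_zero μ hL).le) zero_le).symm
  rcases hq1.eq_or_lt with rfl | hq1
  · exact ⟨_, ironedRevenue_one.2⟩
  have hq : q ≠ ∞ := (hq1.trans ENNReal.one_lt_top).ne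
  have hfin := ironedRevenue_ne_top h q
  have hqpos : 0 < q.toReal := ENNReal.toReal_pos hq0 hq
  obtain ⟨c, hc⟩ := exists_isSupportingSlope (pos_iff_ne_zero.2 hq0) hq1 hfin
  set r := (ironedRevenue μ q).toReal with hr
  -- a maximizing sequence, and a subsequence along which everything converges
  obtain ⟨w, -, hw, hwmem⟩ := exists_seq_tendsto_sSup
    (S := {y | ∃ L : PriceLottery, L.saleProb μ = q ∧ L.revenue μ = y})
    (by
      refine ⟨_, PriceLottery.mix 0 ∞ q.toReal ?_, ?_, rfl⟩
      · exact ENNReal.toReal_le_of_le_ofReal zero_le_one (by simpa using hq1.le)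
      · simp [PriceLottery.saleProb, PriceLottery.mix, acceptProb_top, acceptProb_zero]
        exact ENNReal.coe_toNNReal hq) (OrderTop.bddAbove _)
  have hsup : sSup {y | ∃ L : PriceLottery, L.saleProb μ = q ∧ L.revenue μ = y} =
      ironedRevenue μ q := by
    refine le_antisymm (sSup_le ?_) (iSup₂_le fun L hL => le_sSup ⟨L, hL, rfl⟩)
    rintro _ ⟨L, hL, rfl⟩
    exact hL ▸ L.revenue_le_ironedRevenue μ
  rw [hsup] at hw
  choose L hL hLw using hwmem
  -- The acceptance probabilities are separate coordinates, since their limits may differ from those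
  -- of the limit prices.
  obtain ⟨⟨l, u, x, a, b⟩, -, k, hk, hlim⟩ := (isCompact_univ (X := ℝ≥0∞ × ℝ≥0∞ × Set.Icc (0 : ℝ) 1
      × ℝ≥0∞ × ℝ≥0∞)).tendsto_subseq (x := fun j => ((L j).lo, (L j).hi,
        (⟨(L j).x, (L j).x.2, by exact_mod_cast (L j).x_le_one⟩ : Set.Icc (0 : ℝ) 1),
        acceptProb μ (L j).lo, acceptProb μ (L j).hi)) (fun _ => Set.mem_univ _)
  simp only [nhds_prod_eq, tendsto_prod_iff', Function.comp_def] at hlim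
  obtain ⟨hl, hu, hx, ha, hb⟩ := hlim
  obtain ⟨hal, hal'⟩ := tendsto_revenue_eq h hl ha
  obtain ⟨hbu, hbu'⟩ := tendsto_revenue_eq h hu hb
  have hx' : Tendsto (fun j => ((L (k j)).x : ℝ)) atTop (𝓝 (x : ℝ)) :=
    (continuous_subtype_val.tendsto x).comp hx
  have hale : a ≠ ∞ := ne_top_of_le_ne_top (acceptProb_ne_top μ l) hal
  have hble : b ≠ ∞ := ne_top_of_le_ne_top (acceptProb_ne_top μ u) hbu
  have hmulne : ∀ {p a : ℝ≥0∞}, a ≤ acceptProb μ p → p * a ≠ ∞ := fun {p a} hpa =>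
    ne_top_of_le_ne_top (mul_acceptProb_ne_top μ p) (mul_le_mul_right hpa p)
  have tR : ∀ {s : ℕ → ℝ≥0∞} {y}, y ≠ ∞ → Tendsto s atTop (𝓝 y) →
      Tendsto (fun j => (s j).toReal) atTop (𝓝 y.toReal) :=
    fun hy hs => (ENNReal.tendsto_toReal hy).comp hs
  have e1 : (x : ℝ) * a.toReal + (1 - x) * b.toReal = q.toReal := by
    refine tendsto_nhds_unique ((hx'.mul (tR hale ha)).add
      ((tendsto_const_nhds.sub hx').mul (tR hble hb))) ?_
    simp_rw [← PriceLottery.toReal_saleProb, hL]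
    exact tendsto_const_nhds
  have e2 : (x : ℝ) * (l * a).toReal + (1 - x) * (u * b).toReal = r := by
    refine tendsto_nhds_unique ((hx'.mul (tR (hmulne hal) hal')).add
      ((tendsto_const_nhds.sub hx').mul (tR (hmulne hbu) hbu'))) ?_
    simp_rw [← PriceLottery.toReal_revenue, hLw]
    exact tR hfin (hw.comp hk.tendsto_atTop)
  rw [ENNReal.toReal_mul, ENNReal.toReal_mul] at e2
  have toR : ∀ {a p}, a ≤ acceptProb μ p → a.toReal ≤ (acceptProb μ p).toReal :=
    fun hh => ENNReal.toReal_mono (acceptProb_ne_top μ _) hh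
  have la := hc.le_of_le ENNReal.toReal_nonneg (toR hal)
  have lb := hc.le_of_le ENNReal.toReal_nonneg (toR hbu)
  have hx0 := x.2.1
  have hx1 := x.2.2
  have e3 : (x : ℝ) * (r + c * (a.toReal - q.toReal)) +
      (1 - x) * (r + c * (b.toReal - q.toReal)) = r := by linear_combination c * e1
  -- limit points of positive weight lie on the line
  have oa : 0 < (x : ℝ) → l.toReal * a.toReal = r + c * (a.toReal - q.toReal) := by
    intro hpos
    refine le_antisymm la (le_of_mul_le_mul_left ?_ hpos)
    linarith [mul_le_mul_of_nonneg_left lb (sub_nonneg.2 hx1)]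
  have ob : (x : ℝ) < 1 → u.toReal * b.toReal = r + c * (b.toReal - q.toReal) := by
    intro hpos
    refine le_antisymm lb (le_of_mul_le_mul_left ?_ (sub_pos.2 hpos))
    linarith [mul_le_mul_of_nonneg_left la hx0]
  have concl : ∀ {p p' a a' : ℝ≥0∞}, a ≤ acceptProb μ p → a' ≤ acceptProb μ p' →
      p.toReal * a.toReal = r + c * (a.toReal - q.toReal) →
      p'.toReal * a'.toReal = r + c * (a'.toReal - q.toReal) →
      a.toReal ≤ q.toReal → q.toReal ≤ a'.toReal → ∃ L : PriceLottery, L.IsOptimal μ q := by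
    intro p p' a a' hp hp' o o' hle hge
    obtain ⟨p₁, h1, h1'⟩ := (hc.onLine ENNReal.toReal_nonneg (toR hp) o).2 hle
    exact exists_isOptimal_of_onLine hq hfin h1
      ((hc.onLine ENNReal.toReal_nonneg (toR hp') o').1 hge hqpos) h1' (hge.trans (toR hp'))
  -- If one weight vanishes in the limit, the other limit point sits exactly over `q` and serves on
  -- both sides.
  rcases hx0.eq_or_lt with h0 | h0
  · rw [← h0] at e1 ob
    have : b.toReal = q.toReal := by linarith
    exact concl hbu hbu (ob one_pos) (ob one_pos) this.le this.ge
  rcases hx1.eq_or_lt with h1 | h1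
  · rw [h1] at e1
    have : a.toReal = q.toReal := by linarith
    exact concl hal hal (oa h0) (oa h0) this.le this.ge
  rcases le_total a.toReal q.toReal with hle | hle
  · exact concl hal hbu (oa h0) (ob h1) hle (by
      refine le_of_mul_le_mul_left ?_ (sub_pos.2 h1)
      nlinarith)
  · exact concl hbu hal (ob h1) (oa h0) (by
      refine le_of_mul_le_mul_left ?_ (sub_pos.2 h1)
      nlinarith) hle

end Attained

/-! ### Integrating out one coordinate -/

section Update

variable {ι : Type*} [DecidableEq ι] {X : ι → Type*} [∀ i, MeasurableSpace (X i)]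
  (μ : ∀ i, Measure (X i)) [∀ i, IsProbabilityMeasure (μ i)]

lemma measurable_lintegral_update {F : (∀ i, X i) → ℝ≥0∞} (hF : Measurable F) (i : ι) :
    Measurable fun v => ∫⁻ b, F (Function.update v i b) ∂μ i := by
  rw [← lmarginal_singleton]
  exact hF.lmarginal μ

variable [Fintype ι]

/-- Resampling one coordinate preserves a product law; this replaces conditioning on the other
values. -/
lemma lintegral_pi_update {F : (∀ i, X i) → ℝ≥0∞} (hF : Measurable F) (i : ι) :
    ∫⁻ v, ∫⁻ b, F (Function.update v i b) ∂μ i ∂Measure.pi μ = ∫⁻ v, F v ∂Measure.pi μ := by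
  have : ∀ i, Nonempty (X i) := fun i => nonempty_of_isProbabilityMeasure (μ i)
  have x : ∀ i, X i := fun i => Classical.arbitrary _
  rw [lintegral_eq_lmarginal_univ x, lintegral_eq_lmarginal_univ x,
    lmarginal_erase' _ hF (Finset.mem_univ i),
    lmarginal_erase' _ (measurable_lintegral_update μ hF i) (Finset.mem_univ i)]
  simp

/-- A function of one coordinate is independent of a function that does not depend on it. -/
lemma lintegral_pi_mul_of_update {i : ι} {g : X i → ℝ≥0∞} {h : (∀ i, X i) → ℝ≥0∞}
    (hg : Measurable g) (hh : Measurable h) (hu : ∀ v b, h (Function.update v i b) = h v) :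
    ∫⁻ v, g (v i) * h v ∂Measure.pi μ = (∫⁻ b, g b ∂μ i) * ∫⁻ v, h v ∂Measure.pi μ := by
  rw [← lintegral_pi_update μ (F := fun v => g (v i) * h v)
    ((hg.comp (measurable_pi_apply i)).mul hh) i, ← lintegral_const_mul _ hh]
  refine lintegral_congr fun v => ?_
  simp only [hu, Function.update_self]
  rw [lintegral_mul_const _ hg]

end Update

/-! ### The revenue of Myerson's mechanism -/

section Myerson

variable {n : ℕ} {I : BSMD n} {φ : Fin n → ℝ → ℝ} {M : Mechanism n}

instance : IsProbabilityMeasure I.valueLaw := by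
  unfold BSMD.valueLaw; infer_instance

lemma Mechanism.serveProb_le_one (M : Mechanism n) (I : BSMD n) (i : Fin n) :
    M.serveProb I i ≤ 1 := prob_le_one

lemma BSMD.ae_nonneg (I : BSMD n) : ∀ᵐ v ∂I.valueLaw, ∀ i, 0 ≤ v i := by
  rw [ae_all_iff]
  exact fun i => (Measure.tendsto_eval_ae_ae (μ := I.dist) (i := i)).eventually (I.nonneg i)

/-- The probability, given the other values, that agent `i` is served. -/
noncomputable def Mechanism.condServeProb (M : Mechanism n) (I : BSMD n) (i : Fin n)
    (v : Fin n → ℝ) : ℝ≥0∞ :=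
  I.dist i {b | i ∈ M.alloc (Function.update v i b)}

/-- The expected payment of agent `i`, given the other values. -/
noncomputable def Mechanism.condPay (M : Mechanism n) (I : BSMD n) (i : Fin n)
    (v : Fin n → ℝ) : ℝ≥0∞ :=
  ∫⁻ b, ENNReal.ofReal (M.pay (Function.update v i b) i) ∂I.dist i

namespace IsMyersonMechanism

lemma measurableSet_update (hM : IsMyersonMechanism I φ M) (i : Fin n) (v : Fin n → ℝ) :
    MeasurableSet {b | i ∈ M.alloc (Function.update v i b)} :=
  measurable_update v (hM.measurable_alloc i)

lemma condServeProb_eq (hM : IsMyersonMechanism I φ M) (i : Fin n) (v : Fin n → ℝ) :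
    M.condServeProb I i v =
      ∫⁻ b, Set.indicator {v | i ∈ M.alloc v} 1 (Function.update v i b) ∂I.dist i := by
  rw [Mechanism.condServeProb, ← lintegral_indicator_one (hM.measurableSet_update i v)]
  rfl

lemma measurable_condServeProb (hM : IsMyersonMechanism I φ M) (i : Fin n) :
    Measurable (M.condServeProb I i) := by
  rw [funext (hM.condServeProb_eq i)]
  exact measurable_lintegral_update I.dist
    (measurable_one.indicator (hM.measurable_alloc i)) i

lemma measurable_condPay (hM : IsMyersonMechanism I φ M) (i : Fin n) :
    Measurable (M.condPay I i) :=
  measurable_lintegral_update I.dist (hM.measurable_pay i).ennreal_ofReal i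

lemma lintegral_condServeProb (hM : IsMyersonMechanism I φ M) (i : Fin n) :
    ∫⁻ v, M.condServeProb I i v ∂I.valueLaw = M.serveProb I i := by
  simp_rw [hM.condServeProb_eq i]
  rw [BSMD.valueLaw, lintegral_pi_update I.dist
    (measurable_one.indicator (hM.measurable_alloc i)) i,
    lintegral_indicator_one (hM.measurable_alloc i)]
  rfl

lemma lintegral_condPay (hM : IsMyersonMechanism I φ M) (i : Fin n) :
    ∫⁻ v, M.condPay I i v ∂I.valueLaw = ∫⁻ v, ENNReal.ofReal (M.pay v i) ∂I.valueLaw :=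
  lintegral_pi_update I.dist (hM.measurable_pay i).ennreal_ofReal i

/-- Given the other values, agent `i` faces a price that it accepts whenever it is served. -/
lemma exists_threshold (hM : IsMyersonMechanism I φ M) (i : Fin n) {v : Fin n → ℝ}
    (hv : ∀ j, 0 ≤ v j) : ∃ t : ℝ, 0 ≤ t ∧
      M.condServeProb I i v ≤ acceptProb (I.dist i) (ENNReal.ofReal t) ∧
      M.condPay I i v = ENNReal.ofReal t * M.condServeProb I i v := by
  set S : Set ℝ := {b | 0 ≤ b ∧ i ∈ M.alloc (Function.update v i b)} with hS
  have hbdd : BddBelow S := ⟨0, fun b hb => hb.1⟩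
  refine ⟨sInf S, Real.sInf_nonneg fun b hb => hb.1, ?_, ?_⟩
  -- Bids that win lie above their infimum; this inclusion is all the segment argument needs.
  · refine measure_mono_ae ?_
    filter_upwards [I.nonneg i] with b hb0 hb
    exact ENNReal.ofReal_le_ofReal (csInf_le hbdd ⟨hb0, hb⟩)
  · rw [Mechanism.condServeProb, ← setLIntegral_const, ← lintegral_indicator
      (hM.measurableSet_update i v), Mechanism.condPay]
    refine lintegral_congr_ae ?_
    filter_upwards [I.nonneg i] with b hb
    have hb' : ∀ j, 0 ≤ Function.update v i b j := by
      intro j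
      rcases eq_or_ne j i with rfl | hj
      · simpa using hb
      · simpa [hj] using hv j
    rw [hM.pay_eq _ hb' i]
    simp only [Function.update_idem, ← hS]
    by_cases hmem : i ∈ M.alloc (Function.update v i b)
    · rw [if_pos hmem, Set.indicator_of_mem (by exact hmem)]
    · rw [if_neg hmem, Set.indicator_of_notMem (by exact hmem), ENNReal.ofReal_zero]

lemma condPay_eq_zero (hM : IsMyersonMechanism I φ M) (i : Fin n) {v : Fin n → ℝ}
    (hv : ∀ j, 0 ≤ v j) (h : M.condServeProb I i v = 0) : M.condPay I i v = 0 := by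
  obtain ⟨t, -, -, ht⟩ := hM.exists_threshold i hv
  rw [ht, h, mul_zero]

lemma condPay_le_quantilePrice (hM : IsMyersonMechanism I φ M) (i : Fin n) {v : Fin n → ℝ}
    (hv : ∀ j, 0 ≤ v j) (h : M.condServeProb I i v = 1) :
    M.condPay I i v ≤ quantilePrice (I.dist i) 1 := by
  obtain ⟨t, -, h1, ht⟩ := hM.exists_threshold i hv
  rw [h] at h1
  rw [ht, h, mul_one]
  exact le_quantilePrice h1

/-- The expected payment of agent `i` is bounded by the supporting line. -/
lemma lintegral_pay_le_of_isSupportingSlope (hM : IsMyersonMechanism I φ M) (i : Fin n)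
    {r : ℝ≥0∞} (hr : r ≠ ∞) {c : ℝ}
    (hc : IsSupportingSlope (I.dist i) (M.serveProb I i).toReal r.toReal c) :
    ∫⁻ v, ENNReal.ofReal (M.pay v i) ∂I.valueLaw ≤ r := by
  set q := M.serveProb I i with hq
  have hqt : q ≠ ∞ := ne_top_of_le_ne_top ENNReal.one_ne_top (M.serveProb_le_one I i)
  -- The slope may have either sign: its positive and negative parts go to opposite sides, which
  -- avoids subtraction in `ℝ≥0∞`.
  set α : ℝ≥0∞ := ENNReal.ofReal c with hα
  set β : ℝ≥0∞ := ENNReal.ofReal (-c) with hβ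
  have key : ∀ᵐ v ∂I.valueLaw, M.condPay I i v + (α * q + β * M.condServeProb I i v) ≤
      r + α * M.condServeProb I i v + β * q := by
    filter_upwards [I.ae_nonneg] with v hv
    obtain ⟨t, ht0, ht, hpay⟩ := hM.exists_threshold i hv
    rw [hpay]
    set s := M.condServeProb I i v
    have hst : s ≠ ∞ := measure_ne_top _ _
    have hs := hc.le_of_le (ENNReal.toReal_nonneg (a := s))
      (ENNReal.toReal_mono (acceptProb_ne_top _ _) ht)
    rw [ENNReal.toReal_ofReal ht0] at hs
    rw [← ENNReal.ofReal_toReal hst, ← ENNReal.ofReal_toReal hqt, ← ENNReal.ofReal_toReal hr,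
      hα, hβ]
    have hs0 := ENNReal.toReal_nonneg (a := s)
    have hq0 := ENNReal.toReal_nonneg (a := q)
    have hr0 := ENNReal.toReal_nonneg (a := r)
    rcases le_total 0 c with h0 | h0
    · rw [ENNReal.ofReal_of_nonpos (neg_nonpos.2 h0), zero_mul, zero_mul, add_zero, add_zero,
        ← ENNReal.ofReal_mul ht0, ← ENNReal.ofReal_mul h0, ← ENNReal.ofReal_mul h0,
        ← ENNReal.ofReal_add (by positivity) (by positivity),
        ← ENNReal.ofReal_add (by positivity) (by positivity)]
      exact ENNReal.ofReal_le_ofReal (by linarith)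
    · have h0' := neg_nonneg.2 h0
      rw [ENNReal.ofReal_of_nonpos h0, zero_mul, zero_mul, add_zero, zero_add,
        ← ENNReal.ofReal_mul ht0, ← ENNReal.ofReal_mul h0', ← ENNReal.ofReal_mul h0',
        ← ENNReal.ofReal_add (by positivity) (by positivity),
        ← ENNReal.ofReal_add (by positivity) (by positivity)]
      exact ENNReal.ofReal_le_ofReal (by linarith)
  have hmS := hM.measurable_condServeProb i
  have h := lintegral_mono_ae key
  rw [lintegral_add_left (hM.measurable_condPay i), lintegral_add_left measurable_const,
    lintegral_const_mul _ hmS, lintegral_add_right _ measurable_const,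
    lintegral_add_left measurable_const, lintegral_const_mul _ hmS,
    hM.lintegral_condServeProb, ← hq, hM.lintegral_condPay, lintegral_const, lintegral_const,
    lintegral_const, measure_univ, mul_one, mul_one, mul_one, add_assoc r] at h
  -- After averaging, both sides carry the same finite term `α * q + β * q`.
  refine (ENNReal.add_le_add_iff_right ?_).1 h
  exact ENNReal.add_ne_top.2 ⟨ENNReal.mul_ne_top ENNReal.ofReal_ne_top hqt,
    ENNReal.mul_ne_top ENNReal.ofReal_ne_top hqt⟩

lemma lintegral_pay_eq_zero (hM : IsMyersonMechanism I φ M) {i : Fin n}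
    (h : M.serveProb I i = 0) : ∫⁻ v, ENNReal.ofReal (M.pay v i) ∂I.valueLaw = 0 := by
  rw [← hM.lintegral_condServeProb, lintegral_eq_zero_iff (hM.measurable_condServeProb i)] at h
  rw [← hM.lintegral_condPay, lintegral_eq_zero_iff (hM.measurable_condPay i)]
  filter_upwards [h, I.ae_nonneg] with v h hv
  exact hM.condPay_eq_zero i hv h

/-- Being served with probability `1` overall forces conditional probability `1` for almost all
values of the others. -/
lemma lintegral_pay_le_quantilePrice (hM : IsMyersonMechanism I φ M) {i : Fin n}
    (h : M.serveProb I i = 1) :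
    ∫⁻ v, ENNReal.ofReal (M.pay v i) ∂I.valueLaw ≤ quantilePrice (I.dist i) 1 := by
  have hle : ∀ v, M.condServeProb I i v ≤ 1 := fun v => prob_le_one
  have h1 : ∀ᵐ v ∂I.valueLaw, M.condServeProb I i v = 1 := by
    refine ae_eq_of_ae_le_of_lintegral_le (g := fun _ => 1)
      (Filter.Eventually.of_forall hle) ?_ aemeasurable_const ?_
    · rw [hM.lintegral_condServeProb, h]; exact ENNReal.one_ne_top
    · rw [hM.lintegral_condServeProb, h]; simp
  rw [← hM.lintegral_condPay]
  calc ∫⁻ v, M.condPay I i v ∂I.valueLaw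
      ≤ ∫⁻ _, quantilePrice (I.dist i) 1 ∂I.valueLaw := by
        refine lintegral_mono_ae ?_
        filter_upwards [h1, I.ae_nonneg] with v h1 hv
        exact hM.condPay_le_quantilePrice i hv h1
    _ = _ := by simp

/-- The expected payment of agent `i` is at most the ironed revenue at its probability of
service. -/
lemma lintegral_pay_le_ironedRevenue (hM : IsMyersonMechanism I φ M) (i : Fin n) :
    ∫⁻ v, ENNReal.ofReal (M.pay v i) ∂I.valueLaw ≤
      ironedRevenue (I.dist i) (M.serveProb I i) := by
  rcases eq_or_ne (ironedRevenue (I.dist i) (M.serveProb I i)) ∞ with hr | hr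
  · rw [hr]; exact le_top
  rcases eq_or_ne (M.serveProb I i) 0 with h0 | h0
  · rw [hM.lintegral_pay_eq_zero h0]; exact zero_le
  rcases (M.serveProb_le_one I i).eq_or_lt with h1 | h1
  · rw [h1, ironedRevenue_one.1]
    exact hM.lintegral_pay_le_quantilePrice h1
  · obtain ⟨c, hc⟩ := exists_isSupportingSlope (pos_iff_ne_zero.2 h0) h1 hr
    exact hM.lintegral_pay_le_of_isSupportingSlope i hr hc

lemma revenue_le_sum (hM : IsMyersonMechanism I φ M) {r : Fin n → ℝ≥0∞}
    (h : ∀ i, ∫⁻ v, ENNReal.ofReal (M.pay v i) ∂I.valueLaw ≤ r i) :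
    M.revenue I ≤ ∑ i, r i := by
  rw [Mechanism.revenue, lintegral_finsetSum _ fun i _ => (hM.measurable_pay i).ennreal_ofReal]
  exact Finset.sum_le_sum fun i _ => h i

end IsMyersonMechanism

end Myerson

/-! ### The revenue of sequential posted prices -/

/-- Summation by parts: partial sums that are dominated stay dominated when they are weighted with
nonincreasing weights. -/
lemma sum_mul_le_sum_mul_of_antitone {n : ℕ} {e a b : Fin n → ℝ≥0∞} (he : Antitone e)
    (h : ∀ k, (∑ l, if l ≤ k then a l else 0) ≤ ∑ l, if l ≤ k then b l else 0) :
    ∑ l, e l * a l ≤ ∑ l, e l * b l := by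
  induction n with
  | zero => simp
  | succ n ih =>
    -- Splitting off the least weight `z` leaves a multiple of the full sums plus a sum with
    -- nonincreasing weights that no longer involves the last index.
    set z := e (Fin.last n)
    have split : ∀ a : Fin (n + 1) → ℝ≥0∞, ∑ l, e l * a l =
        z * ∑ l, a l + ∑ l : Fin n, (e l.castSucc - z) * a l.castSucc := by
      intro a
      rw [Fin.sum_univ_castSucc, Fin.sum_univ_castSucc, mul_add, Finset.mul_sum, add_right_comm,
        ← Finset.sum_add_distrib]
      congr 1
      refine Finset.sum_congr rfl fun l _ => ?_
      rw [← add_mul, add_tsub_cancel_of_le (he (Fin.le_last _))]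
    rw [split, split]
    refine add_le_add (mul_le_mul_right ?_ _) (ih ?_ ?_)
    · simpa [Fin.le_last] using h (Fin.last n)
    · exact fun i j hij => tsub_le_tsub_right (he (Fin.castSucc_le_castSucc_iff.2 hij)) _
    · intro k
      have := h k.castSucc
      simpa [Fin.sum_univ_castSucc, not_le.2 (Fin.castSucc_lt_last k)] using this

section SPM

variable {n : ℕ} (I : BSMD n) (σ : Equiv.Perm (Fin n))

open Classical in
/-- The agents served among the first `k` of the order `σ`. A profile `ω` holds the value and the
price of each agent. -/
noncomputable def spmStage (ω : Fin n → ℝ × ℝ≥0∞) (k : ℕ) : Finset (Fin n) :=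
  ((List.finRange n).take k).foldl
    (fun A k => if insert (σ k) A ∈ I.feasible ∧ (ω (σ k)).2 ≤ ENNReal.ofReal (ω (σ k)).1
      then insert (σ k) A else A) ∅

/-- The agent at position `l` can be added to those served before. -/
def SPMAvailable (ω : Fin n → ℝ × ℝ≥0∞) (l : Fin n) : Prop :=
  insert (σ l) (spmStage I σ ω l) ∈ I.feasible

/-- The pairs of a value and a price that is accepted. -/
def acceptSet : Set (ℝ × ℝ≥0∞) := {x | x.2 ≤ ENNReal.ofReal x.1}

lemma measurableSet_acceptSet : MeasurableSet acceptSet :=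
  measurableSet_le measurable_snd (ENNReal.measurable_ofReal.comp measurable_fst)

lemma measurable_indicator_acceptSet {g : ℝ≥0∞ → ℝ≥0∞} (hg : Measurable g) :
    Measurable (acceptSet.indicator fun x => g x.2) :=
  (hg.comp measurable_snd).indicator measurableSet_acceptSet

variable {I σ}

lemma spmStage_zero (ω : Fin n → ℝ × ℝ≥0∞) : spmStage I σ ω 0 = ∅ := by
  simp [spmStage]

open Classical in
lemma spmStage_succ (ω : Fin n → ℝ × ℝ≥0∞) (l : Fin n) :
    spmStage I σ ω (l + 1) = if SPMAvailable I σ ω l ∧ ω (σ l) ∈ acceptSet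
      then insert (σ l) (spmStage I σ ω l) else spmStage I σ ω l := by
  have : (List.finRange n)[(l : ℕ)]? = some l := by simp
  rw [spmStage, List.take_add_one, this, Option.toList_some, List.foldl_append,
    List.foldl_cons, List.foldl_nil]
  exact if_congr Iff.rfl rfl rfl

lemma spmServed_eq_spmStage (ω : Fin n → ℝ × ℝ≥0∞) :
    spmServed I σ (fun i => (ω i).1) (fun i => (ω i).2) = spmStage I σ ω n := by
  rw [spmStage, List.take_of_length_le (by simp)]
  rfl

lemma spmStage_induction {P : ℕ → Prop} (h0 : P 0) (h : ∀ l : Fin n, P l → P (l + 1)) :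
    ∀ k ≤ n, P k := by
  intro k hk
  induction k with
  | zero => exact h0
  | succ k ih => exact h ⟨k, hk⟩ (ih (Nat.le_of_succ_le hk))

/-- Earlier stages read only earlier agents; hence availability is independent of an agent's own
value and price. -/
lemma spmStage_update (ω : Fin n → ℝ × ℝ≥0∞) (l : Fin n) (x : ℝ × ℝ≥0∞) {k : ℕ} (hk : k ≤ l) :
    spmStage I σ (Function.update ω (σ l) x) k = spmStage I σ ω k := by
  refine spmStage_induction (P := fun k => k ≤ l →
    spmStage I σ (Function.update ω (σ l) x) k = spmStage I σ ω k) ?_ ?_ k (hk.trans l.2.le) hk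
  · intro _; rw [spmStage_zero, spmStage_zero]
  · intro j ih hj
    have hne : σ j ≠ σ l := fun h => by
      rw [σ.injective h] at hj; omega
    rw [spmStage_succ, spmStage_succ, SPMAvailable, SPMAvailable, ih (by omega),
      Function.update_of_ne hne]

lemma spmStage_feasible (h0 : ∅ ∈ I.feasible) (ω : Fin n → ℝ × ℝ≥0∞) {k : ℕ} (hk : k ≤ n) :
    spmStage I σ ω k ∈ I.feasible := by
  refine spmStage_induction (P := fun k => spmStage I σ ω k ∈ I.feasible) ?_ ?_ k hk
  · rwa [spmStage_zero]
  · intro l ih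
    rw [spmStage_succ]
    split_ifs with h
    · exact h.1
    · exact ih

lemma spmStage_mono (ω : Fin n → ℝ × ℝ≥0∞) {j k : ℕ} (hjk : j ≤ k) (hk : k ≤ n) :
    spmStage I σ ω j ⊆ spmStage I σ ω k := by
  refine spmStage_induction (P := fun k => j ≤ k → spmStage I σ ω j ⊆ spmStage I σ ω k)
    ?_ ?_ k hk hjk
  · intro h; rw [Nat.le_zero.1 h]
  · intro l ih h
    rcases h.eq_or_lt with rfl | h
    · exact subset_rfl
    · refine (ih (by omega)).trans ?_
      rw [spmStage_succ]
      split_ifs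
      · exact Finset.subset_insert _ _
      · exact subset_rfl

lemma exists_of_mem_spmStage (ω : Fin n → ℝ × ℝ≥0∞) {k : ℕ} (hk : k ≤ n) {i : Fin n}
    (hi : i ∈ spmStage I σ ω k) : ∃ l : Fin n, (l : ℕ) < k ∧ σ l = i := by
  refine spmStage_induction (P := fun k => i ∈ spmStage I σ ω k → ∃ l : Fin n, (l : ℕ) < k ∧ σ l = i)
    ?_ ?_ k hk hi
  · intro h; rw [spmStage_zero] at h; simp at h
  · intro j ih h
    rw [spmStage_succ] at h
    split_ifs at h
    · rcases Finset.mem_insert.1 h with rfl | h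
      · exact ⟨j, by omega, rfl⟩
      · obtain ⟨l, hl, e⟩ := ih h; exact ⟨l, by omega, e⟩
    · obtain ⟨l, hl, e⟩ := ih h; exact ⟨l, by omega, e⟩

open Classical in
lemma sum_spmStage (ω : Fin n → ℝ × ℝ≥0∞) (g : Fin n → ℝ≥0∞) {k : ℕ} (hk : k ≤ n) :
    ∑ i ∈ spmStage I σ ω k, g i = ∑ l : Fin n, if (l : ℕ) < k then
      (if SPMAvailable I σ ω l ∧ ω (σ l) ∈ acceptSet then g (σ l) else 0) else 0 := by
  refine spmStage_induction (P := fun k => ∑ i ∈ spmStage I σ ω k, g i = ∑ l : Fin n,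
    if (l : ℕ) < k then
      (if SPMAvailable I σ ω l ∧ ω (σ l) ∈ acceptSet then g (σ l) else 0) else 0) ?_ ?_ k hk
  · simp [spmStage_zero]
  · intro j ih
    have e : ∀ l : Fin n, (if (l : ℕ) < j + 1 then
        (if SPMAvailable I σ ω l ∧ ω (σ l) ∈ acceptSet then g (σ l) else 0) else 0) =
        (if (l : ℕ) < j then
          (if SPMAvailable I σ ω l ∧ ω (σ l) ∈ acceptSet then g (σ l) else 0) else 0) +
        (if l = j then
          (if SPMAvailable I σ ω l ∧ ω (σ l) ∈ acceptSet then g (σ l) else 0) else 0) := by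
      intro l
      rcases lt_trichotomy (l : ℕ) j with h | h | h
      · rw [if_pos (show (l : ℕ) < j + 1 by omega), if_pos h,
          if_neg (show l ≠ j from fun h' => h.ne (congrArg _ h')), add_zero]
      · rw [if_pos (show (l : ℕ) < j + 1 by omega), if_neg h.not_lt, if_pos (Fin.ext h), zero_add]
      · rw [if_neg (show ¬ (l : ℕ) < j + 1 by omega), if_neg h.not_gt,
          if_neg (show l ≠ j from fun h' => h.ne' (congrArg _ h')), add_zero]
    simp_rw [e]
    rw [Finset.sum_add_distrib, ← ih, Finset.sum_ite_eq', if_pos (Finset.mem_univ _),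
      spmStage_succ]
    have hnot : σ j ∉ spmStage I σ ω j := fun h => by
      obtain ⟨l, hl, e⟩ := exists_of_mem_spmStage ω j.2.le h
      rw [σ.injective e] at hl
      exact lt_irrefl _ hl
    split_ifs
    · rw [Finset.sum_insert hnot, add_comm]
    · rw [add_zero]

lemma measurableSet_spmStage {k : ℕ} (hk : k ≤ n) (s : Set (Finset (Fin n))) :
    MeasurableSet {ω | spmStage I σ ω k ∈ s} := by
  -- All `s` are treated at once, since the step pulls `s` back along an insertion.
  refine spmStage_induction (P := fun k => ∀ s : Set (Finset (Fin n)),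
    MeasurableSet {ω | spmStage I σ ω k ∈ s}) ?_ ?_ k hk s
  · intro s
    simp [spmStage_zero]
  · intro l ih s
    have hacc : MeasurableSet {ω : Fin n → ℝ × ℝ≥0∞ | ω (σ l) ∈ acceptSet} :=
      measurable_pi_apply (σ l) measurableSet_acceptSet
    have hC : MeasurableSet {ω : Fin n → ℝ × ℝ≥0∞ |
        SPMAvailable I σ ω l ∧ ω (σ l) ∈ acceptSet} :=
      (ih {A | insert (σ l) A ∈ I.feasible}).inter hacc
    have hT := ih {A | insert (σ l) A ∈ s}
    convert! (hC.inter hT).union (hC.compl.inter (ih s)) using 1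
    ext ω
    simp only [spmStage_succ, Set.mem_ofPred_eq, Set.mem_union, Set.mem_inter_iff,
      Set.mem_compl_iff]
    split_ifs with h <;> simp [h]

lemma measurableSet_spmAvailable (l : Fin n) : MeasurableSet {ω | SPMAvailable I σ ω l} :=
  measurableSet_spmStage l.2.le {A | insert (σ l) A ∈ I.feasible}

lemma lintegral_indicator_acceptSet (μ : Measure ℝ) [IsProbabilityMeasure μ] (ν : Measure ℝ≥0∞)
    [IsProbabilityMeasure ν] {g : ℝ≥0∞ → ℝ≥0∞} (hg : Measurable g) :
    ∫⁻ x, acceptSet.indicator (fun x => g x.2) x ∂(μ.prod ν) = ∫⁻ p, g p * acceptProb μ p ∂ν := by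
  rw [lintegral_prod_symm' _ (measurable_indicator_acceptSet hg)]
  refine lintegral_congr fun p => ?_
  rw [acceptProb, ← setLIntegral_const, ← lintegral_indicator
    (measurableSet_le measurable_const ENNReal.measurable_ofReal)]
  rfl

variable (I) in
/-- The joint law of the values and the prices. -/
noncomputable def spmLaw (ν : Fin n → Measure ℝ≥0∞) : Measure (Fin n → ℝ × ℝ≥0∞) :=
  Measure.pi fun i => (I.dist i).prod (ν i)

variable (ν : Fin n → Measure ℝ≥0∞) [∀ i, IsProbabilityMeasure (ν i)]

instance : IsProbabilityMeasure (spmLaw I ν) := by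
  unfold spmLaw; infer_instance

/-- Whether an agent is available does not depend on its own value and price. -/
lemma lintegral_spmLaw_available (l : Fin n) {g : ℝ≥0∞ → ℝ≥0∞} (hg : Measurable g) :
    ∫⁻ ω, acceptSet.indicator (fun x => g x.2) (ω (σ l)) *
        {ω | SPMAvailable I σ ω l}.indicator 1 ω ∂spmLaw I ν =
      (∫⁻ p, g p * acceptProb (I.dist (σ l)) p ∂ν (σ l)) *
        spmLaw I ν {ω | SPMAvailable I σ ω l} := by
  rw [spmLaw, lintegral_pi_mul_of_update (fun i => (I.dist i).prod (ν i))
    (measurable_indicator_acceptSet hg)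
    (measurable_one.indicator (measurableSet_spmAvailable l)),
    lintegral_indicator_acceptSet _ _ hg, lintegral_indicator_one (measurableSet_spmAvailable l)]
  intro ω x
  have : SPMAvailable I σ (Function.update ω (σ l) x) l ↔ SPMAvailable I σ ω l := by
    rw [SPMAvailable, SPMAvailable, spmStage_update ω l x le_rfl]
  by_cases h : SPMAvailable I σ ω l
  · rw [Set.indicator_of_mem (by exact this.2 h), Set.indicator_of_mem (by exact h)]
    rfl
  · rw [Set.indicator_of_notMem (by exact mt this.1 h), Set.indicator_of_notMem (by exact h)]

/-- By independence, each agent contributes its single-agent revenue times its probability of being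
available. -/
lemma spmRevenue_eq : spmRevenue I σ ν = ∑ l, (∫⁻ p, p * acceptProb (I.dist (σ l)) p ∂ν (σ l)) *
    spmLaw I ν {ω | SPMAvailable I σ ω l} := by
  classical
  -- Regrouping makes the value and the price of one agent a single coordinate of a product law.
  have hmp := measurePreserving_arrowProdEquivProdArrow ℝ ℝ≥0∞ (Fin n) I.dist ν
  rw [spmRevenue, BSMD.valueLaw, ← hmp.lintegral_comp_emb (MeasurableEquiv.measurableEmbedding _)]
  calc _ = ∫⁻ ω, ∑ l, acceptSet.indicator (fun x => x.2) (ω (σ l)) *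
        {ω | SPMAvailable I σ ω l}.indicator 1 ω ∂spmLaw I ν := by
        refine lintegral_congr fun ω => ?_
        change ∑ i ∈ spmServed I σ (fun i => (ω i).1) (fun i => (ω i).2), (ω i).2 = _
        rw [spmServed_eq_spmStage, sum_spmStage ω _ le_rfl]
        refine Finset.sum_congr rfl fun l _ => ?_
        by_cases h1 : ω (σ l) ∈ acceptSet <;> by_cases h2 : SPMAvailable I σ ω l <;>
          simp [h1, h2]
    _ = _ := by
        rw [lintegral_finsetSum]
        · exact Finset.sum_congr rfl fun l _ => lintegral_spmLaw_available ν l measurable_id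
        · exact fun l _ => ((measurable_snd.indicator measurableSet_acceptSet).comp
            (measurable_pi_apply _)).mul
            (measurable_one.indicator (measurableSet_spmAvailable l))

end SPM

/-! ### Blocked agents in an intersection of matroids -/

section Intersection

variable {n m : ℕ} {I : BSMD n} {N : Fin m → Matroid (Fin n)} {σ : Equiv.Perm (Fin n)}

open Classical in
/-- Agents that the matroid `a` blocks are few in every feasible set. -/
lemma card_blocked_le
    (hN : ∀ A : Finset (Fin n), A ∈ I.feasible ↔ ∀ a, (N a).Indep (A : Set (Fin n)))
    (ω : Fin n → ℝ × ℝ≥0∞) (a : Fin m) (k : Fin n) {B : Finset (Fin n)} (hB : B ∈ I.feasible) :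
    (Finset.univ.filter fun l : Fin n => (l ≤ k ∧
      ¬ (N a).Indep (insert (σ l) (spmStage I σ ω l : Set (Fin n)))) ∧ σ l ∈ B).card ≤
      (spmStage I σ ω (k + 1)).card := by
  by_contra! hlt
  set T := Finset.univ.filter fun l : Fin n => (l ≤ k ∧
      ¬ (N a).Indep (insert (σ l) (spmStage I σ ω l : Set (Fin n)))) ∧ σ l ∈ B with hT
  have h0 : ∅ ∈ I.feasible := (hN ∅).2 fun a => by simp
  have hS := (hN _).1 (spmStage_feasible (σ := σ) h0 ω k.2) a
  have hJ : (N a).Indep ((T.map σ.toEmbedding : Finset (Fin n)) : Set (Fin n)) := by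
    refine ((hN _).1 hB a).subset ?_
    intro i hi
    obtain ⟨l, hl, rfl⟩ := Finset.mem_map.1 (Finset.mem_coe.1 hi)
    exact (Finset.mem_filter.1 hl).2.2
  -- Too many blocked agents in `B` would let augmentation add a blocked one to the stage after `k`,
  -- hence to the smaller stage at which it was blocked.
  obtain ⟨i, hi, hind⟩ := hS.augment hJ (by
    rw [Set.encard_coe_eq_coe_finsetCard, Set.encard_coe_eq_coe_finsetCard, Finset.card_map]
    exact_mod_cast hlt)
  obtain ⟨l, hl, rfl⟩ := Finset.mem_map.1 (Finset.mem_coe.1 hi.1)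
  obtain ⟨hlk, hbl⟩ := (Finset.mem_filter.1 hl).2.1
  refine hbl (hind.subset (Set.insert_subset_insert ?_))
  exact_mod_cast spmStage_mono ω (by have : (l : ℕ) ≤ k := hlk; omega) k.2

open Classical in
-- The run `ω` fixes the blocked agents, and `M` acts on fresh values `v`; the counting bound for `B
-- = M.alloc v` is averaged over `v`.
lemma sum_blocked_serveProb_le
    (hN : ∀ A : Finset (Fin n), A ∈ I.feasible ↔ ∀ a, (N a).Indep (A : Set (Fin n)))
    {M : Mechanism n} (hmeas : ∀ i, MeasurableSet {v | i ∈ M.alloc v})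
    (hfeas : ∀ v, M.alloc v ∈ I.feasible)
    (ω : Fin n → ℝ × ℝ≥0∞) (a : Fin m) (k : Fin n) :
    (∑ l, if l ≤ k then (if ¬ (N a).Indep (insert (σ l) (spmStage I σ ω l : Set (Fin n)))
      then M.serveProb I (σ l) else 0) else 0) ≤
    ∑ l, if l ≤ k then
      (if SPMAvailable I σ ω l ∧ ω (σ l) ∈ acceptSet then (1 : ℝ≥0∞) else 0) else 0 := by
  set T := Finset.univ.filter fun l : Fin n => l ≤ k ∧
      ¬ (N a).Indep (insert (σ l) (spmStage I σ ω l : Set (Fin n))) with hT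
  calc _ = ∑ l ∈ T, M.serveProb I (σ l) := by
        rw [hT, Finset.sum_filter]
        exact Finset.sum_congr rfl fun l _ => by rw [ite_and]
    _ = ∫⁻ v, ∑ l ∈ T, {v | σ l ∈ M.alloc v}.indicator 1 v ∂I.valueLaw := by
        rw [lintegral_finsetSum _ fun l _ => measurable_one.indicator (hmeas (σ l))]
        exact Finset.sum_congr rfl fun l _ => (lintegral_indicator_one (hmeas (σ l))).symm
    _ ≤ ∫⁻ _, ((spmStage I σ ω (k + 1)).card : ℝ≥0∞) ∂I.valueLaw := by
        refine lintegral_mono fun v => ?_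
        have h := card_blocked_le (σ := σ) hN ω a k (hfeas v)
        rw [← Finset.filter_filter, ← hT] at h
        calc _ = ((T.filter fun l => σ l ∈ M.alloc v).card : ℝ≥0∞) := by
              rw [Finset.card_filter, Nat.cast_sum]
              refine Finset.sum_congr rfl fun l _ => ?_
              by_cases hl : σ l ∈ M.alloc v <;> simp [hl]
          _ ≤ _ := by exact_mod_cast h
    _ = ∑ i ∈ spmStage I σ ω (k + 1), 1 := by simp
    _ = _ := by
        rw [sum_spmStage ω _ k.2]
        refine Finset.sum_congr rfl fun l _ => ?_
        simp only [Nat.lt_succ_iff, Fin.val_fin_le]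

/-- Sequential posted prices `e` in decreasing order earn a fraction `1 / (m + 1)` of
`∑ i, e i * q i`, where `q i` is the probability of service of agent `i` in a feasible mechanism. -/
theorem sum_mul_serveProb_le_spmRevenue
    (hN : ∀ A : Finset (Fin n), A ∈ I.feasible ↔ ∀ a, (N a).Indep (A : Set (Fin n)))
    {M : Mechanism n} (hmeas : ∀ i, MeasurableSet {v | i ∈ M.alloc v})
    (hfeas : ∀ v, M.alloc v ∈ I.feasible)
    (ν : Fin n → Measure ℝ≥0∞) [∀ i, IsProbabilityMeasure (ν i)] {e : Fin n → ℝ≥0∞}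
    (he : Antitone fun l => e (σ l))
    (hq : ∀ i, ∫⁻ p, acceptProb (I.dist i) p ∂ν i = M.serveProb I i)
    (hR : ∀ i, ∫⁻ p, p * acceptProb (I.dist i) p ∂ν i = e i * M.serveProb I i) :
    ∑ i, e i * M.serveProb I i ≤ (m + 1) * spmRevenue I σ ν := by
  classical
  set q := M.serveProb I with hqdef
  set served : (Fin n → ℝ × ℝ≥0∞) → Fin n → ℝ≥0∞ := fun ω l =>
    acceptSet.indicator (fun _ => 1) (ω (σ l)) * {ω | SPMAvailable I σ ω l}.indicator 1 ω
    with hserved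
  have hserved' : ∀ ω l, served ω l =
      if SPMAvailable I σ ω l ∧ ω (σ l) ∈ acceptSet then (1 : ℝ≥0∞) else 0 := by
    intro ω l
    by_cases h1 : ω (σ l) ∈ acceptSet <;> by_cases h2 : SPMAvailable I σ ω l <;>
      simp [hserved, h1, h2]
  have hmserved : ∀ l, Measurable fun ω => served ω l := fun l =>
    ((measurable_const.indicator measurableSet_acceptSet).comp (measurable_pi_apply _)).mul
      (measurable_one.indicator (measurableSet_spmAvailable l))
  have hav : ∀ l, Measurable fun ω =>
      {ω | SPMAvailable I σ ω l}.indicator (1 : (Fin n → ℝ × ℝ≥0∞) → ℝ≥0∞) ω := fun l =>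
    measurable_one.indicator (measurableSet_spmAvailable l)
  have blocked : ∀ ω a, ∑ l, e (σ l) *
      (if ¬ (N a).Indep (insert (σ l) (spmStage I σ ω l : Set (Fin n))) then q (σ l) else 0) ≤
      ∑ l, e (σ l) * served ω l := fun ω a => by
    refine sum_mul_le_sum_mul_of_antitone he fun k => ?_
    simp_rw [hserved']
    exact sum_blocked_serveProb_le hN hmeas hfeas ω a k
  -- Each agent is either available or blocked by at least one matroid; every matroid's share is
  -- charged to the agents served.
  have pointwise : ∀ ω, ∑ l, e (σ l) * q (σ l) ≤
      ∑ l, e (σ l) * q (σ l) * {ω | SPMAvailable I σ ω l}.indicator 1 ω +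
        m * ∑ l, e (σ l) * served ω l := by
    intro ω
    calc ∑ l, e (σ l) * q (σ l) ≤
          ∑ l, (e (σ l) * q (σ l) * {ω | SPMAvailable I σ ω l}.indicator 1 ω +
            ∑ a, e (σ l) * (if ¬ (N a).Indep (insert (σ l) (spmStage I σ ω l : Set (Fin n)))
              then q (σ l) else 0)) := by
          refine Finset.sum_le_sum fun l _ => ?_
          by_cases h : SPMAvailable I σ ω l
          · rw [Set.indicator_of_mem (by exact h), Pi.one_apply, mul_one]
            exact le_self_add
          · have h' := h
            rw [SPMAvailable, hN] at h'
            push Not at h'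
            obtain ⟨a, ha⟩ := h'
            rw [Finset.coe_insert] at ha
            refine le_add_left ?_
            refine le_trans ?_ (Finset.single_le_sum (fun _ _ => zero_le) (Finset.mem_univ a))
            rw [if_pos ha]
      _ = ∑ l, e (σ l) * q (σ l) * {ω | SPMAvailable I σ ω l}.indicator 1 ω +
            ∑ a, ∑ l, e (σ l) *
              (if ¬ (N a).Indep (insert (σ l) (spmStage I σ ω l : Set (Fin n)))
                then q (σ l) else 0) := by
          rw [Finset.sum_add_distrib, Finset.sum_comm]
      _ ≤ _ := by
          refine add_le_add le_rfl ((Finset.sum_le_sum fun a _ => blocked ω a).trans ?_)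
          simp
  have hint := lintegral_mono (μ := spmLaw I ν) pointwise
  rw [lintegral_const, measure_univ, mul_one, lintegral_add_left
      (Finset.measurable_fun_sum _ fun l _ => (hav l).const_mul _),
    lintegral_const_mul _ (Finset.measurable_fun_sum _ fun l _ => (hmserved l).const_mul _),
    lintegral_finsetSum _ fun l _ => (hav l).const_mul _,
    lintegral_finsetSum _ fun l _ => (hmserved l).const_mul _] at hint
  have e1 : ∀ l, ∫⁻ ω, e (σ l) * q (σ l) * {ω | SPMAvailable I σ ω l}.indicator 1 ω ∂spmLaw I ν =
      (∫⁻ p, p * acceptProb (I.dist (σ l)) p ∂ν (σ l)) *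
        spmLaw I ν {ω | SPMAvailable I σ ω l} := fun l => by
    rw [lintegral_const_mul _ (hav l), lintegral_indicator_one (measurableSet_spmAvailable l), hR]
  -- Charging `e` per sale also yields the SPM revenue: a sale given availability has probability
  -- `q`, and `e * q` is the single-agent revenue.
  have e2 : ∀ l, ∫⁻ ω, e (σ l) * served ω l ∂spmLaw I ν =
      (∫⁻ p, p * acceptProb (I.dist (σ l)) p ∂ν (σ l)) *
        spmLaw I ν {ω | SPMAvailable I σ ω l} := fun l => by
    rw [lintegral_const_mul _ (hmserved l), lintegral_spmLaw_available ν l measurable_const]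
    simp_rw [one_mul]
    rw [hq, hR, mul_assoc]
  simp_rw [e1, e2, ← spmRevenue_eq] at hint
  calc ∑ i, e i * q i = ∑ l, e (σ l) * q (σ l) :=
        (Equiv.sum_comp σ fun i => e i * q i).symm
    _ ≤ _ := by rw [add_mul, one_mul, add_comm]; exact hint

end Intersection

/-! ### The approximation theorem -/

/-- The tangent is available only for `0 < q < 1`, so the end points are treated directly. -/
lemma IsMyersonMechanism.lintegral_pay_le_of_isRegularDist {n : ℕ} {I : BSMD n}
    {φ : Fin n → ℝ → ℝ} {M : Mechanism n} (hM : IsMyersonMechanism I φ M) {i : Fin n} {f : ℝ → ℝ}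
    (hf : IsRegularDist (I.dist i) f) :
    ∫⁻ v, ENNReal.ofReal (M.pay v i) ∂I.valueLaw ≤
      quantilePrice (I.dist i) (M.serveProb I i) * M.serveProb I i := by
  rcases eq_or_ne (M.serveProb I i) 0 with h0 | h0
  · rw [hM.lintegral_pay_eq_zero h0]; exact zero_le
  rcases (M.serveProb_le_one I i).eq_or_lt with h1 | h1
  · rw [h1, mul_one]
    exact hM.lintegral_pay_le_quantilePrice h1
  · exact hM.lintegral_pay_le_of_isSupportingSlope i
      (ENNReal.mul_ne_top (quantilePrice_ne_top h0 h1.le) (h1.trans ENNReal.one_lt_top).ne)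
      (hf.isSupportingSlope (I.nonneg i) (pos_iff_ne_zero.2 h0) h1)

/-- First part: regular distributions, where the price `F⁻¹(1 - q)` is posted to each agent.
Second part: arbitrary distributions, possibly irregular or with point masses, where the prices
are drawn at random. -/
theorem mainTheorem7 {n m : ℕ} (I : BSMD n) (N : Fin m → Matroid (Fin n))
    (hN : ∀ A : Finset (Fin n), A ∈ I.feasible ↔ ∀ a, (N a).Indep (A : Set (Fin n))) :
    (∀ f : Fin n → ℝ → ℝ, (∀ i, IsRegularDist (I.dist i) (f i)) →
      ∀ M : Mechanism n, IsMyersonMechanism I (fun i => virtualValue (I.dist i) (f i)) M →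
      ∀ p : Fin n → ℝ≥0∞, (∀ i, p i = quantilePrice (I.dist i) (M.serveProb I i)) →
      ∀ σ : Equiv.Perm (Fin n), Antitone (fun k => p (σ k)) →
        M.revenue I ≤ (m + 1) * spmRevenue I σ (fun i => Measure.dirac (p i))) ∧
    (∀ M : Mechanism n, IsMyersonMechanism I (fun i => ironedVirtualValue (I.dist i)) M →
      ((∀ i, Integrable (fun v : ℝ => v) (I.dist i)) →
        ∀ i, ∃ L : PriceLottery, L.IsOptimal (I.dist i) (M.serveProb I i)) ∧
      ∀ L : Fin n → PriceLottery,
        (∀ i, (L i).IsOptimal (I.dist i) (M.serveProb I i)) →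
      ∀ σ : Equiv.Perm (Fin n),
        Antitone (fun k => (L (σ k)).effectivePrice (I.dist (σ k))) →
        M.revenue I ≤ (m + 1) * spmRevenue I σ (fun i => (L i).law)) := by
  refine ⟨fun f hf M hM p hp σ hσ => ?_, fun M hM => ⟨fun hint i => ?_, fun L hL σ hσ => ?_⟩⟩
  · have hacc : ∀ i, acceptProb (I.dist i) (p i) = M.serveProb I i := fun i => by
      rw [hp i]
      exact (hf i).acceptProb_quantilePrice (I.nonneg i) (M.serveProb_le_one I i)
    refine (hM.revenue_le_sum fun i => ?_).trans (sum_mul_serveProb_le_spmRevenue hN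
      hM.measurable_alloc hM.feasible (fun i => Measure.dirac (p i)) hσ ?_ ?_)
    · rw [hp i]
      exact hM.lintegral_pay_le_of_isRegularDist (hf i)
    · intro i
      rw [lintegral_dirac, hacc]
    · intro i
      rw [lintegral_dirac, hacc]
  · refine exists_isOptimal ?_ (M.serveProb_le_one I i)
    have h := (hint i).2
    rw [hasFiniteIntegral_iff_ofReal (I.nonneg i)] at h
    exact h.ne
  · have hrev : ∀ i, (L i).effectivePrice (I.dist i) * M.serveProb I i =
        (L i).revenue (I.dist i) := fun i => by
      rw [← (hL i).1, PriceLottery.effectivePrice_mul_saleProb]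
    refine (hM.revenue_le_sum fun i => ?_).trans (sum_mul_serveProb_le_spmRevenue hN
      hM.measurable_alloc hM.feasible (fun i => (L i).law)
      (e := fun i => (L i).effectivePrice (I.dist i)) hσ ?_ ?_)
    · rw [hrev, (hL i).2]
      exact hM.lintegral_pay_le_ironedRevenue i
    · intro i
      rw [PriceLottery.lintegral_law, ← (hL i).1, PriceLottery.saleProb]
    · intro i
      rw [PriceLottery.lintegral_law, hrev, PriceLottery.revenue]
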